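/- Let $\Theta$ be a variety of groups and, for a finite set $X$, let $W(X)$ be the free group of $\Theta$ over $X$. For $G\in\Theta$ and $T\subseteq W(X)$, the $G$-closure $T''_G$ is the intersection of the kernels of all homomorphisms $\mu : W(X)\to G$ with $T\subseteq\ker\mu$. Groups $G,H\in\Theta$ are geometrically equivalent, written $G\sim H$, if $T''_G=T''_H$ for every finite set $X$ and every $T\subseteq W(X)$. For a torsion-free nilpotent group $G$, let $\sqrt G$ denote its Mal'tsev completion, i.e. the minimal torsion-free nilpotent group containing $G$ in which every element has an $n$-th root for every positive integer $n$. Theorem 4. Let $G_1,G_2\in\Theta$ be finitely generated torsion-free nilpotent groups of class $2$ whose centres have rank $2$. Then $G_1\sim G_2$ if and only if (at least) one of the following holds: there is a finitely generated torsion-free nilpotent group $N$ of class $2$ with cyclic centre such that $G_1\sim N\sim G_2$; or $\sqrt{G_1}\cong\sqrt{G_2}$ as groups. -/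

import Mathlib

namespace GeomEquivalence

/-! ### Varieties of groups and their free groups

A variety of groups is given by a set `Θ` of laws, i.e. of words in countably many variables. -/

/-- The group `G` belongs to the variety of groups with set of laws `Θ`. -/
def InVariety (Θ : Set (FreeGroup ℕ)) (G : Type*) [Group G] : Prop :=
  ∀ w ∈ Θ, ∀ f : ℕ → G, FreeGroup.lift f w = 1

/-- The verbal subgroup of `F`: the normal subgroup generated by all values in `F` of the
laws in `Θ`. -/
def verbalSubgroup (Θ : Set (FreeGroup ℕ)) (F : Type*) [Group F] : Subgroup F :=
  Subgroup.normalClosure {x | ∃ w ∈ Θ, ∃ f : ℕ → F, FreeGroup.lift f w = x}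

instance verbalSubgroup_normal (Θ : Set (FreeGroup ℕ)) (F : Type*) [Group F] :
    (verbalSubgroup Θ F).Normal := by
  unfold verbalSubgroup
  infer_instance

/-- The free group `W(X)` over `X` of the variety with set of laws `Θ`. -/
abbrev RelFreeGroup (Θ : Set (FreeGroup ℕ)) (X : Type*) : Type _ :=
  FreeGroup X ⧸ verbalSubgroup Θ (FreeGroup X)

/-! ### Geometric equivalence -/

/-- The algebraic variety `T'_G`: all homomorphisms `W → G` whose kernel contains `T`. -/
def algVariety {W : Type*} [Group W] (G : Type*) [Group G] (T : Set W) : Set (W →* G) :=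
  {μ | T ⊆ (μ.ker : Set W)}

/-- The `G`-closure `T''_G`: the intersection of the kernels of all `μ ∈ T'_G`. -/
def algClosure {W : Type*} [Group W] (G : Type*) [Group G] (T : Set W) : Subgroup W :=
  ⨅ μ ∈ algVariety G T, μ.ker

/-- Geometric equivalence `G ∼ H` of two groups of the variety with set of laws `Θ`: for every
finite set `X`, the `G`-closure and the `H`-closure of every subset of `W(X)` coincide. -/
def GeomEquiv (Θ : Set (FreeGroup ℕ)) (G H : Type*) [Group G] [Group H] : Prop :=
  InVariety Θ G ∧ InVariety Θ H ∧
    ∀ (X : Type) [Finite X] (T : Set (RelFreeGroup Θ X)), algClosure G T = algClosure H T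

/-! ### Torsion-free nilpotent groups and their Mal'tsev completions -/

/-- `G` is torsion free: only the identity has finite order. -/
def TorsionFree (G : Type*) [Group G] : Prop :=
  ∀ g : G, IsOfFinOrder g → g = 1

/-- `G` is a finitely generated torsion-free nilpotent group of class (exactly) `2`. -/
structure IsFGTorsionFreeClassTwo (G : Type*) [Group G] : Prop where
  fg : Group.FG G
  torsionFree : TorsionFree G
  nilpotent : Group.IsNilpotent G
  classTwo : Group.nilpotencyClass G = 2

open scoped IsMulCommutative in
/-- The rank of the center of `G`, as an abelian group (a `ℤ`-module). -/
noncomputable def centerRank (G : Type*) [Group G] : ℕ :=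
  Module.finrank ℤ (Additive (Subgroup.center G))

/-- The subgroup `H` of `D` is complete: every element of `H` has in `H` an `n`-th root for every
positive integer `n`. -/
def IsComplete {D : Type*} [Group D] (H : Subgroup D) : Prop :=
  ∀ x ∈ H, ∀ n : ℕ, 0 < n → ∃ y ∈ H, y ^ n = x

/-- `ι : G → D` is a Mal'tsev completion of `G`: `D` is a complete torsion-free nilpotent group
that contains `G` (through the embedding `ι`), and it is minimal as such: no proper subgroup
of `D` that contains `G` is complete. -/
structure IsMalcevCompletion {G D : Type*} [Group G] [Group D] (ι : G →* D) : Prop where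
  injective : Function.Injective ι
  nilpotent : Group.IsNilpotent D
  torsionFree : TorsionFree D
  complete : IsComplete (⊤ : Subgroup D)
  minimal : ∀ H : Subgroup D, ι.range ≤ H → IsComplete H → H = ⊤

/-- `√G ≅ √H`: the groups `G` and `H` have Mal'tsev completions that are isomorphic
as groups. -/
def IsoMalcevCompletions.{u, v} (G : Type u) (H : Type v) [Group G] [Group H] : Prop :=
  ∃ (D : Type u) (_ : Group D) (ι : G →* D) (E : Type v) (_ : Group E) (κ : H →* E),
    IsMalcevCompletion ι ∧ IsMalcevCompletion κ ∧ Nonempty (D ≃* E)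

end GeomEquivalence

namespace GeomEquivalence

open Subgroup
open scoped commutatorElement

/-! ### Separation by homomorphisms -/

/-! For finitely generated groups, geometric equivalence means that each group is separated by
homomorphisms into the other (`geomEquiv_iff`). A finitely generated torsion-free group of class 2
is a central extension `TwistedProd β` of `ℤ^m` by its centre `ℤ^r`, with nondegenerate commutator
form `altForm β`. Up to bounded factors, homomorphisms between such extensions that respect the
central parts are pairs of additive maps compatible with the commutator forms
(`TwistedProd.homOfCompat`, `TwistedProd.altForm_induced`). Separation need only be tested on the
centre (`TwistedProd.separatedBy`).

The candidates for `N` are Heisenberg groups. With `n` the maximal size of a hyperbolic family of a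
form, `HeisenbergGroup n` is separated by the group of that form. Conversely, a group is separated
by `HeisenbergGroup n` as soon as every central `z ≠ 0` is detected by a functional `g` for which
the integral form obtained by applying `g` has no hyperbolic family of size `n + 1`: an integral
alternating form is rationally symplectic plus radical (`exists_compat_heisForm`).

Let two groups with centre of rank 2 separate each other. If the commutators of one of them span
only rank 1, that group is equivalent to a Heisenberg group. Otherwise every homomorphism maps
centre to centre. If no homomorphism in one direction is injective on the centre, each of them has
central image of rank at most 1, so separation passes through a scalar form and factors through a
Heisenberg group, which is then equivalent to both. If there are centre-injective homomorphisms both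
ways, nondegeneracy makes them injective and comparing ranks makes each element of the target have a
power in the image, so both groups share a completion.

Conversely, inside a common completion a fixed power of each basis element of one group lies in the
other, which gives a compatible pair injective on the centre (`IsMalcevCompletion.separatedBy`). -/

/-- The homomorphisms `G → H` separate the points of `G`. -/
def SeparatedBy (G H : Type*) [Group G] [Group H] : Prop :=
  ∀ g : G, g ≠ 1 → ∃ φ : G →* H, φ g ≠ 1

theorem SeparatedBy.of_injective {G H : Type*} [Group G] [Group H] (φ : G →* H)
    (hφ : Function.Injective φ) : SeparatedBy G H :=
  fun _ hg => ⟨φ, fun h => hg (hφ (h.trans (map_one φ).symm))⟩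

theorem SeparatedBy.trans {G H K : Type*} [Group G] [Group H] [Group K]
    (h₁ : SeparatedBy G H) (h₂ : SeparatedBy H K) : SeparatedBy G K := by
  intro g hg
  obtain ⟨φ, hφ⟩ := h₁ g hg
  obtain ⟨ψ, hψ⟩ := h₂ _ hφ
  exact ⟨ψ.comp φ, hψ⟩

theorem InVariety.of_separatedBy {Θ : Set (FreeGroup ℕ)} {G H : Type*} [Group G] [Group H]
    (hG : InVariety Θ G) (h : SeparatedBy H G) : InVariety Θ H := by
  intro w hw f
  by_contra hne
  obtain ⟨φ, hφ⟩ := h _ hne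
  apply hφ
  rw [← hG w hw (φ ∘ f)]
  exact DFunLike.congr_fun (FreeGroup.ext_hom (φ.comp (FreeGroup.lift f))
    (FreeGroup.lift (φ ∘ f)) (fun a => by simp)) w

theorem InVariety.verbalSubgroup_le_ker {Θ : Set (FreeGroup ℕ)} {F G : Type*} [Group F] [Group G]
    (hG : InVariety Θ G) (φ : F →* G) : verbalSubgroup Θ F ≤ φ.ker := by
  apply Subgroup.normalClosure_le_normal
  rintro x ⟨w, hw, f, rfl⟩
  have : φ.comp (FreeGroup.lift f) = FreeGroup.lift (φ ∘ f) :=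
    FreeGroup.ext_hom _ _ (fun a => by simp)
  exact (DFunLike.congr_fun this w).trans (hG w hw _)

theorem mem_algClosure {W : Type*} [Group W] {G : Type*} [Group G] {T : Set W} {w : W} :
    w ∈ algClosure G T ↔ ∀ μ : W →* G, T ⊆ (μ.ker : Set W) → μ w = 1 := by
  simp [algClosure, algVariety, Subgroup.mem_iInf, MonoidHom.mem_ker]

theorem SeparatedBy.algClosure_le {G H : Type*} [Group G] [Group H] (h : SeparatedBy G H)
    {W : Type*} [Group W] (T : Set W) : algClosure H T ≤ algClosure G T := by
  intro w hw
  rw [mem_algClosure] at hw ⊢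
  intro μ hμ
  by_contra hne
  obtain ⟨φ, hφ⟩ := h _ hne
  refine hφ (hw (φ.comp μ) fun t ht => ?_)
  have : μ t = 1 := hμ ht
  simp [MonoidHom.mem_ker, this]

/-- Write `G` as a quotient `π` of `W(X)` with `X` finite and take `T = ker π`. A word with
nontrivial image lies outside the `G`-closure of `T`, hence outside its `H`-closure; a map to `H`
witnessing this kills `ker π` and so factors through `G`. -/
theorem separatedBy_of_algClosure_eq {Θ : Set (FreeGroup ℕ)} {G H : Type*} [Group G] [Group H]
    [hfg : Group.FG G] (hG : InVariety Θ G)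
    (h : ∀ (X : Type) [Finite X] (T : Set (RelFreeGroup Θ X)), algClosure H T ≤ algClosure G T) :
    SeparatedBy G H := by
  obtain ⟨X, hX, φ, hφ⟩ := Group.fg_iff_exists_freeGroup_hom_surjective_finite.1 hfg
  let π : RelFreeGroup Θ X →* G := QuotientGroup.lift _ φ (hG.verbalSubgroup_le_ker φ)
  have hπ : Function.Surjective π := fun g => by
    obtain ⟨x, rfl⟩ := hφ g
    exact ⟨QuotientGroup.mk x, rfl⟩
  intro g hg
  obtain ⟨w, rfl⟩ := hπ g
  have hw : w ∉ algClosure H (π.ker : Set (RelFreeGroup Θ X)) := fun hw =>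
    hg (mem_algClosure.1 (h X _ hw) π subset_rfl)
  rw [mem_algClosure] at hw
  push Not at hw
  obtain ⟨μ, hμ, hne⟩ := hw
  refine ⟨π.liftOfSurjective hπ ⟨μ, hμ⟩, ?_⟩
  rwa [MonoidHom.liftOfRightInverse_comp_apply]

theorem geomEquiv_iff {Θ : Set (FreeGroup ℕ)} {G H : Type*} [Group G] [Group H]
    [Group.FG G] [Group.FG H] :
    GeomEquiv Θ G H ↔
      InVariety Θ G ∧ InVariety Θ H ∧ SeparatedBy G H ∧ SeparatedBy H G := by
  refine ⟨fun ⟨hG, hH, h⟩ => ⟨hG, hH, ?_, ?_⟩, fun ⟨hG, hH, h₁, h₂⟩ => ⟨hG, hH, ?_⟩⟩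
  · exact separatedBy_of_algClosure_eq hG fun X _ T => (h X T).ge
  · exact separatedBy_of_algClosure_eq hH fun X _ T => (h X T).le
  · exact fun X _ T => le_antisymm (h₂.algClosure_le T) (h₁.algClosure_le T)

/-! ### Torsion-free nilpotent groups -/

theorem TorsionFree.eq_one_of_pow {G : Type*} [Group G] (h : TorsionFree G) {x : G} {n : ℕ}
    (hn : 0 < n) (hx : x ^ n = 1) : x = 1 :=
  h x (isOfFinOrder_iff_pow_eq_one.2 ⟨n, hn, hx⟩)

theorem TorsionFree.of_injective {G H : Type*} [Group G] [Group H] (h : TorsionFree H)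
    (φ : G →* H) (hφ : Function.Injective φ) : TorsionFree G :=
  fun _ hg => hφ ((h _ (φ.isOfFinOrder hg)).trans (map_one φ).symm)

/-- Induction along the upper central series: for `y` in the next term, `⁅y, x⁆` already commutes
with `x`, so comparing `n`-th powers in `y * x * y⁻¹ = ⁅y, x⁆ * x` yields `⁅y, x⁆ ^ n = 1`. -/
theorem TorsionFree.mem_center_of_pow_mem {G : Type*} [Group G] [hnil : Group.IsNilpotent G]
    (h : TorsionFree G) {x : G} {n : ℕ} (hn : 0 < n) (hx : x ^ n ∈ center G) :
    x ∈ center G := by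
  have key : ∀ i, ∀ y ∈ Subgroup.upperCentralSeries G i, Commute y x := by
    intro i
    induction i with
    | zero =>
      intro y hy
      rw [Subgroup.upperCentralSeries_zero, Subgroup.mem_bot] at hy
      rw [hy]
      exact Commute.one_left x
    | succ i ih =>
      intro y hy
      have hc := ih _ (Subgroup.mem_upperCentralSeries_succ_iff.1 hy x)
      have h1 : (y * x * y⁻¹) ^ n = x ^ n := by
        rw [conj_pow, mem_center_iff.1 hx y, mul_inv_cancel_right]
      have h2 : y * x * y⁻¹ = ⁅y, x⁆ * x := by rw [commutatorElement_def]; group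
      rw [h2, hc.mul_pow, mul_eq_right] at h1
      exact commutatorElement_eq_one_iff_commute.1 (h.eq_one_of_pow hn h1)
  obtain ⟨i, hi⟩ := hnil.nilpotent
  exact mem_center_iff.2 fun y => key i y (hi ▸ Subgroup.mem_top y)

theorem TorsionFree.quotient_center {G : Type*} [Group G] [Group.IsNilpotent G]
    (h : TorsionFree G) : TorsionFree (G ⧸ center G) := by
  intro g hg
  obtain ⟨n, hn, hgn⟩ := isOfFinOrder_iff_pow_eq_one.1 hg
  obtain ⟨x, rfl⟩ := QuotientGroup.mk_surjective g
  rw [← QuotientGroup.mk_pow, QuotientGroup.eq_one_iff] at hgn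
  exact (QuotientGroup.eq_one_iff x).2 (h.mem_center_of_pow_mem hn hgn)

/-- Modulo the centre, where torsion-freeness persists, the roots agree by induction; they then
differ by a central element whose `n`-th power is trivial. -/
theorem TorsionFree.pow_left_injective {G : Type*} [Group G] [Group.IsNilpotent G]
    (h : TorsionFree G) {x y : G} {n : ℕ} (hn : 0 < n) (hxy : x ^ n = y ^ n) : x = y := by
  revert h x y
  refine Group.nilpotent_center_quotient_ind
    (P := fun G _ _ => TorsionFree G → ∀ {x y : G}, x ^ n = y ^ n → x = y) G ?_ ?_
  · intro G _ _ _ x y _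
    exact Subsingleton.elim x y
  · intro G _ _ ih h x y hxy
    have h1 : (x : G ⧸ center G) = y := ih h.quotient_center (by
      rw [← QuotientGroup.mk_pow, hxy, QuotientGroup.mk_pow])
    rw [QuotientGroup.eq] at h1
    have h2 : y = x * (x⁻¹ * y) := by group
    have h3 : Commute x (x⁻¹ * y) := mem_center_iff.1 h1 x
    rw [h2, h3.mul_pow, left_eq_mul] at hxy
    rw [h2, h.eq_one_of_pow hn hxy, mul_one]

/-! ### Groups with central commutators -/

/-- The group `G` is nilpotent of class at most `2`. -/
def CentralCommutators (G : Type*) [Group G] : Prop :=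
  ∀ a b : G, ⁅a, b⁆ ∈ center G

namespace CentralCommutators

variable {G : Type*} [Group G]

theorem mul_right (h : CentralCommutators G) (a b c : G) : ⁅a, b * c⁆ = ⁅a, b⁆ * ⁅a, c⁆ := by
  rw [commutatorElement_mul_right_eq_mul_conj, mul_assoc ⁅a, b⁆, mem_center_iff.1 (h a c) b,
    mul_assoc, mul_inv_cancel_right]

theorem mul_left (h : CentralCommutators G) (a b c : G) : ⁅a * b, c⁆ = ⁅a, c⁆ * ⁅b, c⁆ := by
  rw [← commutatorElement_inv, h.mul_right, mul_inv_rev, commutatorElement_inv,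
    commutatorElement_inv, mem_center_iff.1 (h a c)]

theorem pow_right (h : CentralCommutators G) (a b : G) (n : ℕ) : ⁅a, b ^ n⁆ = ⁅a, b⁆ ^ n :=
  map_pow (⟨⟨fun b => ⁅a, b⁆, commutatorElement_one_right a⟩, h.mul_right a⟩ : G →* G) b n

theorem pow_left (h : CentralCommutators G) (a b : G) (n : ℕ) : ⁅a ^ n, b⁆ = ⁅a, b⁆ ^ n :=
  map_pow (⟨⟨fun a => ⁅a, b⁆, commutatorElement_one_left b⟩, fun a c => h.mul_left a c b⟩ :
    G →* G) a n

theorem mul_pow (h : CentralCommutators G) (a b : G) (n : ℕ) :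
    (a * b) ^ n = a ^ n * b ^ n * ⁅b, a⁆ ^ n.choose 2 := by
  induction n with
  | zero => simp
  | succ n ih =>
    have hz : ∀ (k : ℕ) (x : G), ⁅b, a⁆ ^ k * x = x * ⁅b, a⁆ ^ k := fun k x =>
      (mem_center_iff.1 (pow_mem (h b a) k) x).symm
    have hc : b ^ n * a = ⁅b, a⁆ ^ n * (a * b ^ n) := by
      rw [← h.pow_left, commutatorElement_def]; group
    calc (a * b) ^ (n + 1) = a ^ n * b ^ n * (⁅b, a⁆ ^ n.choose 2 * (a * b)) := by
          rw [pow_succ, ih, mul_assoc]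
      _ = a ^ n * (b ^ n * a) * b * ⁅b, a⁆ ^ n.choose 2 := by rw [hz]; simp only [mul_assoc]
      _ = a ^ n * (a * b ^ n) * b * (⁅b, a⁆ ^ n.choose 2 * ⁅b, a⁆ ^ n) := by
          rw [hc, hz]; simp only [mul_assoc]; rw [hz]; simp only [mul_assoc]
      _ = _ := by
          rw [Nat.choose_succ_succ' n 1, Nat.choose_one_right, ← pow_add, add_comm (n.choose 2),
            pow_succ a, pow_succ b]
          simp only [mul_assoc]

/-- In a group of class at most `2`, the elements with a power in a subgroup form a subgroup. -/
def isolator (h : CentralCommutators G) (B : Subgroup G) : Subgroup G where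
  carrier := {x | ∃ n : ℕ, 0 < n ∧ x ^ n ∈ B}
  one_mem' := ⟨1, one_pos, by simp⟩
  inv_mem' := by
    rintro x ⟨n, hn, hx⟩
    exact ⟨n, hn, by simpa using hx⟩
  mul_mem' := by
    rintro x y ⟨n, hn, hx⟩ ⟨m, hm, hy⟩
    -- The factor 2 makes the binomial coefficient a multiple of `m * n`, so the correction term is
    -- a power of `⁅y ^ m, x ^ n⁆`, which lies in `B`.
    refine ⟨2 * (n * m), by positivity, ?_⟩
    rw [h.mul_pow]
    have hc : (2 * (n * m)).choose 2 = (m * n) * (2 * (n * m) - 1) := by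
      rw [Nat.choose_two_right, mul_assoc, Nat.mul_div_cancel_left _ two_pos, mul_comm n m]
    refine mul_mem (mul_mem ?_ ?_) ?_
    · rw [show 2 * (n * m) = n * (2 * m) by ring, pow_mul]
      exact pow_mem hx _
    · rw [show 2 * (n * m) = m * (2 * n) by ring, pow_mul]
      exact pow_mem hy _
    · rw [hc, pow_mul, pow_mul, ← h.pow_left, ← h.pow_right]
      refine pow_mem ?_ _
      rw [commutatorElement_def]
      exact mul_mem (mul_mem (mul_mem hy hx) (inv_mem hy)) (inv_mem hx)

end CentralCommutators

/-! ### Complete groups -/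

/-- Conjugating a root of `x` by an element commuting with `x` gives another root of `x`, and roots
are unique. -/
theorem isComplete_centralizer {D : Type*} [Group D] [Group.IsNilpotent D] (h : TorsionFree D)
    (hc : IsComplete (⊤ : Subgroup D)) (S : Set D) : IsComplete (centralizer S) := by
  intro x hx n hn
  obtain ⟨y, -, rfl⟩ := hc x (Subgroup.mem_top x) n hn
  refine ⟨y, mem_centralizer_iff.2 fun s hs => ?_, rfl⟩
  have h1 : (s * y * s⁻¹) ^ n = y ^ n := by
    rw [conj_pow, mem_centralizer_iff.1 hx s hs, mul_inv_cancel_right]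
  exact mul_inv_eq_iff_eq_mul.1 (h.pow_left_injective hn h1)

theorem isComplete_top_of_surjective {D E : Type*} [Group D] [Group E] (φ : D →* E)
    (hφ : Function.Surjective φ) (h : IsComplete (⊤ : Subgroup D)) :
    IsComplete (⊤ : Subgroup E) := by
  intro x _ n hn
  obtain ⟨d, rfl⟩ := hφ x
  obtain ⟨y, -, rfl⟩ := h d (Subgroup.mem_top d) n hn
  exact ⟨φ y, Subgroup.mem_top _, (map_pow φ y n).symm⟩

theorem IsComplete.comap_mk_center {D : Type*} [Group D]
    (hc : IsComplete (⊤ : Subgroup D)) {H : Subgroup (D ⧸ center D)}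
    (hH : IsComplete H) (hr : ∀ (x y : D ⧸ center D) (n : ℕ), 0 < n → x ^ n = y ^ n → x = y) :
    IsComplete (H.comap (QuotientGroup.mk' (center D))) := by
  intro x hx n hn
  obtain ⟨y, -, rfl⟩ := hc x (Subgroup.mem_top x) n hn
  obtain ⟨z, hz, hzx⟩ := hH _ hx n hn
  refine ⟨y, ?_, rfl⟩
  rw [map_pow] at hzx
  rwa [Subgroup.mem_comap, ← hr _ _ n hn hzx]

namespace IsMalcevCompletion

variable {G D : Type*} [Group G] [Group D] {ι : G →* D}

theorem map_mem_center (h : IsMalcevCompletion ι) {c : G} (hc : c ∈ center G) :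
    ι c ∈ center D := by
  have := h.nilpotent
  have hle : ι.range ≤ centralizer {ι c} := by
    rintro _ ⟨g, rfl⟩
    rw [mem_centralizer_singleton_iff, ← map_mul, ← map_mul, mem_center_iff.1 hc]
  have htop := h.minimal _ hle (isComplete_centralizer h.torsionFree h.complete _)
  refine mem_center_iff.2 fun d => ?_
  exact mem_centralizer_singleton_iff.1 (htop ▸ Subgroup.mem_top d)

/-- The elements commuting with a fixed `x` modulo the centre form a complete subgroup, so by
minimality it suffices to test them on `G`. This is used twice: first for `x` in the image of `G`,
then for arbitrary `x`. -/
theorem centralCommutators (h : IsMalcevCompletion ι) (hG : CentralCommutators G) :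
    CentralCommutators D := by
  have := h.nilpotent
  have hext : ∀ x : D, (∀ g, ⁅ι g, x⁆ ∈ center D) → ∀ d : D, ⁅d, x⁆ ∈ center D := by
    intro x hx
    have hcomm : ∀ d : D, ⁅d, x⁆ ∈ center D ↔
        d ∈ (centralizer {(x : D ⧸ center D)}).comap (QuotientGroup.mk' (center D)) := by
      intro d
      rw [Subgroup.mem_comap, mem_centralizer_singleton_iff, QuotientGroup.mk'_apply,
        ← commutatorElement_eq_one_iff_mul_comm, ← QuotientGroup.eq_one_iff]
      rfl
    have htop := h.minimal _ (fun _ ⟨g, hg⟩ => hg ▸ (hcomm _).1 (hx g))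
      (h.complete.comap_mk_center
        (isComplete_centralizer h.torsionFree.quotient_center
          (isComplete_top_of_surjective _ (QuotientGroup.mk'_surjective _) h.complete) _)
        fun x y n hn hxy => h.torsionFree.quotient_center.pow_left_injective hn hxy)
    exact fun d => (hcomm d).2 (htop ▸ Subgroup.mem_top d)
  have h1 : ∀ (g : G) (d : D), ⁅d, ι g⁆ ∈ center D := fun g =>
    hext _ fun a => by rw [← map_commutatorElement]; exact h.map_mem_center (hG a g)
  intro a b
  refine hext b (fun g => ?_) a
  rw [← commutatorElement_inv]
  exact inv_mem (h1 g b)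

/-- The isolator of the image of `G` is complete and contains that image, so minimality makes it
everything. -/
theorem exists_pow_mem_range (h : IsMalcevCompletion ι) (hG : CentralCommutators G) (d : D) :
    ∃ n : ℕ, 0 < n ∧ d ^ n ∈ ι.range := by
  have htop := h.minimal ((h.centralCommutators hG).isolator ι.range)
    (fun x hx => ⟨1, one_pos, by simpa using hx⟩) (by
      rintro x ⟨m, hm, hx⟩ n hn
      obtain ⟨y, -, rfl⟩ := h.complete x (Subgroup.mem_top x) n hn
      exact ⟨y, ⟨n * m, by positivity, by rwa [pow_mul]⟩, rfl⟩)
  have : d ∈ (h.centralCommutators hG).isolator ι.range := htop ▸ Subgroup.mem_top d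
  exact this

theorem of_exists_pow_mem_range (hι : Function.Injective ι) [Group.IsNilpotent D]
    (htf : TorsionFree D) (hc : IsComplete (⊤ : Subgroup D))
    (hpow : ∀ d : D, ∃ n : ℕ, 0 < n ∧ d ^ n ∈ ι.range) : IsMalcevCompletion ι where
  injective := hι
  nilpotent := inferInstance
  torsionFree := htf
  complete := hc
  minimal H hH hHc := by
    rw [eq_top_iff]
    intro d _
    obtain ⟨n, hn, hd⟩ := hpow d
    obtain ⟨y, hy, hyd⟩ := hHc _ (hH hd) n hn
    rwa [← htf.pow_left_injective hn hyd]

theorem trans_mulEquiv {E : Type*} [Group E] (h : IsMalcevCompletion ι) (e : D ≃* E) :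
    IsMalcevCompletion (e.toMonoidHom.comp ι) where
  injective := e.injective.comp h.injective
  nilpotent := by
    have := h.nilpotent
    exact Group.nilpotent_of_mulEquiv e
  torsionFree := h.torsionFree.of_injective e.symm.toMonoidHom e.symm.injective
  complete := isComplete_top_of_surjective e.toMonoidHom e.surjective h.complete
  minimal H hH hc := by
    have := h.minimal (H.comap e.toMonoidHom) (fun x ⟨g, hg⟩ => hg ▸ hH ⟨g, rfl⟩) (by
      intro x hx n hn
      obtain ⟨y, hy, hyx⟩ := hc _ hx n hn
      refine ⟨e.symm y, by simpa [Subgroup.mem_comap] using hy, e.injective ?_⟩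
      rw [map_pow, e.apply_symm_apply]
      exact hyx)
    rw [eq_top_iff]
    intro x _
    have hx : e.symm x ∈ H.comap e.toMonoidHom := this ▸ Subgroup.mem_top _
    simpa [Subgroup.mem_comap] using hx

theorem comp_mulEquiv {E : Type*} [Group E] (h : IsMalcevCompletion ι) (e : E ≃* G) :
    IsMalcevCompletion (ι.comp e.toMonoidHom) where
  injective := h.injective.comp e.injective
  nilpotent := h.nilpotent
  torsionFree := h.torsionFree
  complete := h.complete
  minimal H hH hc := h.minimal H (fun x ⟨g, hg⟩ => hH ⟨e.symm g, by simpa using hg⟩) hc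

end IsMalcevCompletion

/-! ### Central extensions given by a biadditive cocycle -/

/-- The central extension of `M` by `Z` with cocycle the biadditive map `β`. -/
@[ext]
structure TwistedProd {M Z : Type*} [AddCommGroup M] [AddCommGroup Z] (β : M →+ M →+ Z) where
  fst : M
  snd : Z

/-- The alternating form `β v w - β w v`. -/
def altForm {M Z : Type*} [AddCommGroup M] [AddCommGroup Z] (β : M →+ M →+ Z) : M →+ M →+ Z :=
  β - β.flip

@[simp]
theorem altForm_apply {M Z : Type*} [AddCommGroup M] [AddCommGroup Z] (β : M →+ M →+ Z) (v w : M) :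
    altForm β v w = β v w - β w v := rfl

/-- The radical of the form `ω` is trivial. -/
def FormNondegenerate {M Z : Type*} [AddCommGroup M] [AddCommGroup Z] (ω : M →+ M →+ Z) : Prop :=
  ∀ v, (∀ w, ω v w = 0) → v = 0

namespace TwistedProd

section Group

variable {M Z : Type*} [AddCommGroup M] [AddCommGroup Z] {β : M →+ M →+ Z}

instance : One (TwistedProd β) := ⟨⟨0, 0⟩⟩
instance : Mul (TwistedProd β) := ⟨fun x y => ⟨x.fst + y.fst, x.snd + y.snd + β x.fst y.fst⟩⟩
instance : Inv (TwistedProd β) := ⟨fun x => ⟨-x.fst, -x.snd + β x.fst x.fst⟩⟩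

@[simp] theorem fst_one : (1 : TwistedProd β).fst = 0 := rfl
@[simp] theorem snd_one : (1 : TwistedProd β).snd = 0 := rfl
@[simp] theorem fst_mul (x y : TwistedProd β) : (x * y).fst = x.fst + y.fst := rfl
@[simp] theorem snd_mul (x y : TwistedProd β) :
    (x * y).snd = x.snd + y.snd + β x.fst y.fst := rfl
@[simp] theorem fst_inv (x : TwistedProd β) : x⁻¹.fst = -x.fst := rfl
@[simp] theorem snd_inv (x : TwistedProd β) : x⁻¹.snd = -x.snd + β x.fst x.fst := rfl

instance : Group (TwistedProd β) :=
  Group.ofLeftAxioms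
    (fun x y z => by
      ext
      · simp [add_assoc]
      · simp only [snd_mul, fst_mul, map_add, AddMonoidHom.add_apply]; abel)
    (fun x => by ext <;> simp)
    (fun x => by ext <;> simp)

theorem fst_pow (x : TwistedProd β) (n : ℕ) : (x ^ n).fst = n • x.fst := by
  induction n with
  | zero => simp
  | succ n ih => rw [pow_succ, fst_mul, ih, succ_nsmul]

theorem snd_pow (x : TwistedProd β) (n : ℕ) :
    (x ^ n).snd = n • x.snd + n.choose 2 • β x.fst x.fst := by
  induction n with
  | zero => simp
  | succ n ih =>
    have hc : (n + 1).choose 2 = n + n.choose 2 := by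
      rw [Nat.choose_succ_succ' n 1, Nat.choose_one_right]
    rw [pow_succ, snd_mul, ih, fst_pow, hc, add_nsmul (β x.fst x.fst), succ_nsmul, map_nsmul,
      AddMonoidHom.nsmul_apply]
    abel

theorem commutator_eq (x y : TwistedProd β) : ⁅x, y⁆ = ⟨0, altForm β x.fst y.fst⟩ := by
  rw [commutatorElement_def, mul_assoc, ← mul_inv_rev, mul_inv_eq_iff_eq_mul]
  ext
  · simp [add_comm]
  · simp; abel

theorem mk_zero_mem_center (z : Z) : (⟨0, z⟩ : TwistedProd β) ∈ center (TwistedProd β) := by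
  refine mem_center_iff.2 fun x => ?_
  ext
  · simp
  · simp [add_comm]

theorem mem_center (hβ : FormNondegenerate (altForm β)) {x : TwistedProd β} :
    x ∈ center (TwistedProd β) ↔ x.fst = 0 := by
  constructor
  · intro hx
    refine hβ _ fun w => ?_
    have h1 : ⁅x, (⟨w, 0⟩ : TwistedProd β)⁆ = 1 :=
      commutatorElement_eq_one_iff_mul_comm.2 (mem_center_iff.1 hx _).symm
    rw [commutator_eq] at h1
    exact congrArg snd h1
  · intro hx
    have : x = ⟨0, x.snd⟩ := TwistedProd.ext hx rfl
    rw [this]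
    exact mk_zero_mem_center _

theorem centralCommutators : CentralCommutators (TwistedProd β) := fun x y => by
  rw [commutator_eq]
  exact mk_zero_mem_center _

variable (β) in
/-- The projection to `M`. -/
def fstHom : TwistedProd β →* Multiplicative M where
  toFun x := Multiplicative.ofAdd x.fst
  map_one' := rfl
  map_mul' _ _ := rfl

variable (β) in
/-- The inclusion of `Z`. -/
def inr : Multiplicative Z →* TwistedProd β where
  toFun z := ⟨0, z.toAdd⟩
  map_one' := rfl
  map_mul' x y := by ext <;> simp

theorem mk_zero_nsmul (n : ℕ) (z : Z) :
    (⟨0, n • z⟩ : TwistedProd β) = (⟨0, z⟩ : TwistedProd β) ^ n :=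
  map_pow (inr β) (Multiplicative.ofAdd z) n

theorem mk_zero_eq_one {z : Z} : (⟨0, z⟩ : TwistedProd β) = 1 ↔ z = 0 :=
  ⟨fun h => congrArg snd h, fun h => by rw [h]; rfl⟩

theorem eq_mul (x : TwistedProd β) : x = ⟨x.fst, 0⟩ * ⟨0, x.snd⟩ := by ext <;> simp

theorem mk_add (v w : M) :
    (⟨v + w, 0⟩ : TwistedProd β) = ⟨v, 0⟩ * ⟨w, 0⟩ * ⟨0, -β v w⟩ := by ext <;> simp

theorem torsionFree [IsAddTorsionFree M] [IsAddTorsionFree Z] : TorsionFree (TwistedProd β) := by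
  intro x hx
  obtain ⟨n, hn, h⟩ := isOfFinOrder_iff_pow_eq_one.1 hx
  have h1 : x.fst = 0 := by
    have := congrArg fst h
    rw [fst_pow, fst_one, nsmul_eq_zero_iff] at this
    exact this.resolve_right hn.ne'
  have h2 : x.snd = 0 := by
    have := congrArg snd h
    rw [snd_pow, h1, map_zero, smul_zero, add_zero, snd_one, nsmul_eq_zero_iff] at this
    exact this.resolve_right hn.ne'
  exact TwistedProd.ext h1 h2

theorem isNilpotent : Group.IsNilpotent (TwistedProd β) := by
  refine Subgroup.isNilpotent_of_ker_le_center (fstHom β) fun x hx => ?_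
  have hx0 : x.fst = 0 := hx
  have : x = ⟨0, x.snd⟩ := TwistedProd.ext hx0 rfl
  rw [this]
  exact mk_zero_mem_center _

theorem fg [hM : AddGroup.FG M] [AddGroup.FG Z] : Group.FG (TwistedProd β) := by
  obtain ⟨S, hS, hfin⟩ := Group.fg_iff.1 (inferInstance : Group.FG (Multiplicative M))
  let s : Multiplicative M → TwistedProd β := fun v => ⟨v.toAdd, 0⟩
  have h1 : (inr β).range.FG := (Group.fg_iff_subgroup_fg _).1 inferInstance
  have h2 : (closure (s '' S)).FG := (Subgroup.fg_iff _).2 ⟨_, rfl, hfin.image s⟩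
  refine ⟨?_⟩
  convert h1.sup h2
  symm
  rw [eq_top_iff]
  intro x _
  have h3 : (closure (s '' S)).map (fstHom β) = ⊤ := by
    rw [MonoidHom.map_closure, Set.image_image, ← hS]
    exact congrArg Subgroup.closure (Set.image_id S)
  obtain ⟨y, hy, hyx⟩ := (h3 ▸ Subgroup.mem_top (fstHom β x) :
    fstHom β x ∈ (closure (s '' S)).map (fstHom β))
  have hyx' : y.fst = x.fst := hyx
  rw [← mul_inv_cancel_right x y⁻¹, inv_inv]
  have h4 : x * y⁻¹ ∈ (inr β).range :=
    ⟨Multiplicative.ofAdd (x * y⁻¹).snd, TwistedProd.ext (by simp [hyx', inr]) rfl⟩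
  simpa using mul_mem (mem_sup_left h4 : x * y⁻¹ ∈ (inr β).range ⊔ closure (s '' S))
    (mem_sup_right hy)

/-- An `x` with nonzero first component has, by nondegeneracy, a nontrivial commutator in the
central part; a homomorphism not killing that commutator cannot kill `x`. -/
theorem separatedBy (hβ : FormNondegenerate (altForm β)) {H : Type*} [Group H]
    (h : ∀ z : Z, z ≠ 0 → ∃ φ : TwistedProd β →* H, φ ⟨0, z⟩ ≠ 1) :
    SeparatedBy (TwistedProd β) H := by
  intro x hx
  by_cases hx0 : x.fst = 0
  · have hxz : x = ⟨0, x.snd⟩ := TwistedProd.ext hx0 rfl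
    rw [hxz] at hx ⊢
    exact h _ fun h0 => hx (mk_zero_eq_one.2 h0)
  · obtain ⟨w, hw⟩ : ∃ w, altForm β x.fst w ≠ 0 := by
      by_contra! hcon
      exact hx0 (hβ _ hcon)
    obtain ⟨φ, hφ⟩ := h _ hw
    refine ⟨φ, fun h1 => hφ ?_⟩
    have h2 : (⟨0, altForm β x.fst w⟩ : TwistedProd β) = ⁅x, (⟨w, 0⟩ : TwistedProd β)⁆ :=
      (commutator_eq x ⟨w, 0⟩).symm
    rw [h2, map_commutatorElement, h1, commutatorElement_one_left]

end Group

/-! ### Homomorphisms of central extensions and compatible pairs of additive maps -/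

section Hom

variable {M Z M' Z' : Type*} [AddCommGroup M] [AddCommGroup Z] [AddCommGroup M'] [AddCommGroup Z']
  {β : M →+ M →+ Z} {β' : M' →+ M' →+ Z'}

/-- A homomorphism of central extensions that induces `2u` and `4h`, for additive maps `u` and `h`
compatible with the commutator forms. -/
def homOfCompat (u : M →+ M') (h : Z →+ Z')
    (huh : ∀ v w, altForm β' (u v) (u w) = h (altForm β v w)) :
    TwistedProd β →* TwistedProd β' :=
  -- The difference `σ` of the pulled-back and pushed-forward cocycles is symmetric by `huh`.
  -- Scaling by 2 and 4 replaces it by `4σ`, which is the coboundary of the integral function `v ↦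
  -- 2σ(v, v)`.
  MonoidHom.mk' (fun x => ⟨2 • u x.fst,
      4 • h x.snd + 2 • (β' (u x.fst) (u x.fst) - h (β x.fst x.fst))⟩) (by
    intro x y
    have h1 := huh x.fst y.fst
    simp only [altForm_apply, map_sub] at h1
    rw [sub_eq_sub_iff_add_eq_add, ← sub_eq_zero] at h1
    ext
    · simp
    · rw [← sub_eq_zero]
      refine Eq.trans ?_ ((congrArg (fun t => (-2 : ℤ) • t) h1).trans (smul_zero _))
      simp only [snd_mul, fst_mul, map_add, AddMonoidHom.add_apply, map_nsmul,
        AddMonoidHom.nsmul_apply]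
      abel)

theorem homOfCompat_mk_zero (u : M →+ M') (h : Z →+ Z')
    (huh : ∀ v w, altForm β' (u v) (u w) = h (altForm β v w)) (z : Z) :
    homOfCompat u h huh ⟨0, z⟩ = ⟨0, 4 • h z⟩ := by
  ext <;> simp [homOfCompat]

theorem homOfCompat_mk_zero_ne_one [IsAddTorsionFree Z'] (u : M →+ M') (h : Z →+ Z')
    (huh : ∀ v w, altForm β' (u v) (u w) = h (altForm β v w)) {z : Z} (hz : h z ≠ 0) :
    homOfCompat u h huh ⟨0, z⟩ ≠ 1 := by
  rw [homOfCompat_mk_zero, Ne, mk_zero_eq_one, nsmul_eq_zero_iff]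
  simp [hz]

/-- The map induced on the quotients by a homomorphism that respects the central subgroups. -/
def inducedFst (φ : TwistedProd β →* TwistedProd β') (hφ : ∀ z, (φ ⟨0, z⟩).fst = 0) : M →+ M' :=
  AddMonoidHom.mk' (fun v => (φ ⟨v, 0⟩).fst) (by
    intro v w
    rw [mk_add, map_mul, map_mul, fst_mul, fst_mul, hφ, add_zero])

/-- The map induced on the central subgroups by a homomorphism that respects them. -/
def inducedSnd (φ : TwistedProd β →* TwistedProd β') (hφ : ∀ z, (φ ⟨0, z⟩).fst = 0) : Z →+ Z' :=
  AddMonoidHom.mk' (fun z => (φ ⟨0, z⟩).snd) (by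
    intro z y
    have : (⟨0, z + y⟩ : TwistedProd β) = ⟨0, z⟩ * ⟨0, y⟩ := by ext <;> simp
    rw [this, map_mul, snd_mul, hφ, map_zero, AddMonoidHom.zero_apply, add_zero])

variable (φ : TwistedProd β →* TwistedProd β') (hφ : ∀ z, (φ ⟨0, z⟩).fst = 0)

theorem map_mk_zero (z : Z) : φ ⟨0, z⟩ = ⟨0, inducedSnd φ hφ z⟩ := TwistedProd.ext (hφ z) rfl

theorem fst_map (x : TwistedProd β) : (φ x).fst = inducedFst φ hφ x.fst := by
  conv_lhs => rw [eq_mul x, map_mul, fst_mul, hφ, add_zero]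
  rfl

theorem altForm_induced (v w : M) : altForm β' (inducedFst φ hφ v) (inducedFst φ hφ w) =
    inducedSnd φ hφ (altForm β v w) := by
  have h1 := map_commutatorElement φ (⟨v, 0⟩ : TwistedProd β) ⟨w, 0⟩
  rw [commutator_eq, commutator_eq, map_mk_zero φ hφ] at h1
  exact (congrArg snd h1).symm

end Hom

end TwistedProd

/-! ### Hyperbolic families -/

section Hyperbolic

variable {M Z M' Z' : Type*} [AddCommGroup M] [AddCommGroup Z] [AddCommGroup M'] [AddCommGroup Z']

/-- There is a family of `n` pairwise orthogonal pairs on which the form `ω` takes the same nonzero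
value. -/
def HasHyperbolic (ω : M →+ M →+ Z) (n : ℕ) : Prop :=
  ∃ (e f : Fin n → M) (z : Z), z ≠ 0 ∧ (∀ i j, ω (e i) (e j) = 0) ∧ (∀ i j, ω (f i) (f j) = 0) ∧
    ∀ i j, ω (e i) (f j) = if i = j then z else 0

theorem HasHyperbolic.mono {ω : M →+ M →+ Z} {m n : ℕ} (hmn : m ≤ n) (h : HasHyperbolic ω n) :
    HasHyperbolic ω m := by
  obtain ⟨e, f, z, hz, hee, hff, hef⟩ := h
  refine ⟨e ∘ Fin.castLE hmn, f ∘ Fin.castLE hmn, z, hz, fun i j => hee _ _, fun i j => hff _ _,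
    fun i j => ?_⟩
  simp [hef]

/-- Pairing a linear relation among the `e i` with `f j` isolates its `j`-th coefficient times `z`.
This bound is what makes maximal families exist. -/
theorem HasHyperbolic.le_finrank [Module.Finite ℤ M] [IsAddTorsionFree Z] {ω : M →+ M →+ Z} {n : ℕ}
    (h : HasHyperbolic ω n) : n ≤ Module.finrank ℤ M := by
  obtain ⟨e, f, z, hz, -, -, hef⟩ := h
  have hli : LinearIndependent ℤ e := by
    rw [Fintype.linearIndependent_iff]
    intro c hc j
    have h1 : ω (∑ i, c i • e i) (f j) = 0 := by rw [hc]; simp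
    rw [map_sum, AddMonoidHom.finsetSum_apply, Finset.sum_eq_single j] at h1
    · rw [map_zsmul, AddMonoidHom.coe_smul, Pi.smul_apply, hef, if_pos rfl] at h1
      exact (smul_eq_zero.1 h1).resolve_right hz
    · intro i _ hij
      rw [map_zsmul, AddMonoidHom.coe_smul, Pi.smul_apply, hef, if_neg hij, smul_zero]
    · simp
  simpa using hli.fintype_card_le_finrank

theorem exists_maximal_hasHyperbolic [Module.Finite ℤ M] [IsAddTorsionFree Z] (ω : M →+ M →+ Z)
    {k : ℕ} (hk : HasHyperbolic ω k) :
    ∃ n, k ≤ n ∧ HasHyperbolic ω n ∧ ¬ HasHyperbolic ω (n + 1) := by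
  by_contra! hcon
  have hall : ∀ n, HasHyperbolic ω (k + n) := by
    intro n
    induction n with
    | zero => exact hk
    | succ n ih => exact hcon _ (Nat.le_add_right k n) ih
  have := (hall (Module.finrank ℤ M + 1)).le_finrank
  omega

/-- On the values of `ω`, vanishing under `g` and under `p` are the same condition, so the relations
of the family, including equality of the diagonal values, survive application of `u`. The size `n +
1` provides the index 0 used to name the common value. -/
theorem HasHyperbolic.transfer {ω : M →+ M →+ Z} {ω' : M' →+ M' →+ Z'} (u : M →+ M') (p : Z →+ Z')
    (hup : ∀ v w, ω' (u v) (u w) = p (ω v w)) (g : Z →+ ℤ) (S : AddSubgroup Z)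
    (hS : ∀ v w, ω v w ∈ S) (hg : ∀ y ∈ S, g y = 0 ↔ p y = 0) {n : ℕ}
    (h : HasHyperbolic (ω.compr₂ g) (n + 1)) : HasHyperbolic ω' (n + 1) := by
  obtain ⟨e, f, z, hz, hee, hff, hef⟩ := h
  simp only [AddMonoidHom.compr₂_apply] at hee hff hef
  refine ⟨u ∘ e, u ∘ f, p (ω (e 0) (f 0)), ?_, fun i j => ?_, fun i j => ?_, fun i j => ?_⟩
  · rw [Ne, ← hg _ (hS _ _), hef, if_pos rfl]
    exact hz
  · rw [Function.comp_apply, Function.comp_apply, hup, (hg _ (hS _ _)).1 (hee i j)]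
  · rw [Function.comp_apply, Function.comp_apply, hup, (hg _ (hS _ _)).1 (hff i j)]
  · rw [Function.comp, Function.comp, hup]
    split_ifs with hij
    · rw [← sub_eq_zero, ← map_sub, ← hg _ (sub_mem (hS _ _) (hS _ _)), map_sub, hef, hef,
        if_pos hij, if_pos rfl, sub_self]
    · rw [← hg _ (hS _ _), hef, if_neg hij]

/-! ### The Heisenberg groups -/

/-- The cocycle of the Heisenberg group of rank `2n + 1`. -/
def heisForm (n : ℕ) : (Fin n → ℤ) × (Fin n → ℤ) →+ (Fin n → ℤ) × (Fin n → ℤ) →+ ℤ :=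
  AddMonoidHom.mk' (fun x => AddMonoidHom.mk' (fun y => x.1 ⬝ᵥ y.2) fun y z => by simp)
    fun x y => by ext z; simp

theorem heisForm_apply (n : ℕ) (x y : (Fin n → ℤ) × (Fin n → ℤ)) :
    heisForm n x y = ∑ i, x.1 i * y.2 i := rfl

/-- The integral Heisenberg group of rank `2n + 1`. -/
abbrev HeisenbergGroup (n : ℕ) := TwistedProd (heisForm n)

theorem heisForm_nondegenerate (n : ℕ) : FormNondegenerate (altForm (heisForm n)) := by
  intro v hv
  refine Prod.ext (funext fun i => ?_) (funext fun i => ?_)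
  · simpa [heisForm_apply, Pi.single_apply] using hv (0, Pi.single i 1)
  · simpa [heisForm_apply, Pi.single_apply] using hv (Pi.single i 1, 0)

theorem hasHyperbolic_heisForm (n : ℕ) : HasHyperbolic (altForm (heisForm n)) n := by
  refine ⟨fun i => (Pi.single i 1, 0), fun i => (0, Pi.single i 1), 1, one_ne_zero,
    fun i j => ?_, fun i j => ?_, fun i j => ?_⟩
  · simp [heisForm_apply]
  · simp [heisForm_apply]
  · simp [heisForm_apply, Pi.single_apply, eq_comm]

theorem isFGTorsionFreeClassTwo_heisenbergGroup {n : ℕ} (hn : n ≠ 0) :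
    IsFGTorsionFreeClassTwo (HeisenbergGroup n) where
  fg := TwistedProd.fg
  torsionFree := TwistedProd.torsionFree
  nilpotent := TwistedProd.isNilpotent
  classTwo := by
    have := TwistedProd.isNilpotent (β := heisForm n)
    apply le_antisymm
    · refine (Group.nilpotencyClass_le_of_ker_le_center (TwistedProd.fstHom (heisForm n))
        fun x hx => ?_).trans (Nat.succ_le_succ CommGroup.nilpotencyClass_le_one)
      exact (TwistedProd.mem_center (heisForm_nondegenerate n)).2 hx
    · by_contra hcon
      have h1 := (Group.IsNilpotent.nilpotencyClass_le_one_iff (G := HeisenbergGroup n)).1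
        (by omega)
      obtain ⟨i⟩ : Nonempty (Fin n) := ⟨⟨0, Nat.pos_of_ne_zero hn⟩⟩
      have h2 := h1.is_comm.comm (⟨(Pi.single i 1, 0), 0⟩ : HeisenbergGroup n)
        ⟨(0, Pi.single i 1), 0⟩
      simpa [heisForm_apply, Pi.single_apply] using congrArg TwistedProd.snd h2

theorem isCyclic_center_heisenbergGroup (n : ℕ) : IsCyclic (center (HeisenbergGroup n)) := by
  refine isCyclic_of_surjective ((TwistedProd.inr (heisForm n)).codRestrict
    (center (HeisenbergGroup n)) fun z => TwistedProd.mk_zero_mem_center _) ?_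
  rintro ⟨x, hx⟩
  refine ⟨Multiplicative.ofAdd x.snd, Subtype.ext (TwistedProd.ext ?_ rfl)⟩
  exact ((TwistedProd.mem_center (heisForm_nondegenerate n)).1 hx).symm

/-! ### Comparison of alternating forms with the standard symplectic form -/

theorem exists_heisForm_compat_of_hasHyperbolic {ω : M →+ M →+ Z} (hω : ∀ v, ω v v = 0) {n : ℕ}
    (h : HasHyperbolic ω n) : ∃ (u : (Fin n → ℤ) × (Fin n → ℤ) →+ M) (z : Z), z ≠ 0 ∧
      ∀ x y, ω (u x) (u y) = altForm (heisForm n) x y • z := by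
  obtain ⟨e, f, z, hz, hee, hff, hef⟩ := h
  have hfe : ∀ i j, ω (f i) (e j) = if i = j then -z else 0 := by
    intro i j
    have h1 := hω (f i + e j)
    simp only [map_add, AddMonoidHom.add_apply, hω, hef, add_zero, zero_add] at h1
    rw [eq_neg_of_add_eq_zero_right h1]
    by_cases hij : i = j
    · rw [if_pos hij, if_pos hij.symm]
    · rw [if_neg hij, if_neg (Ne.symm hij), neg_zero]
  refine ⟨AddMonoidHom.mk' (fun x => ∑ i, x.1 i • e i + ∑ i, x.2 i • f i) ?_, z, hz, ?_⟩
  · intro x y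
    simp only [Prod.fst_add, Prod.snd_add, Pi.add_apply, add_smul, Finset.sum_add_distrib]
    abel
  · intro x y
    simp only [AddMonoidHom.mk'_apply, map_add, AddMonoidHom.add_apply, map_sum,
      AddMonoidHom.finsetSum_apply, map_zsmul, AddMonoidHom.coe_smul, Pi.smul_apply, hee, hff, hef,
      hfe, smul_zero, Finset.sum_const_zero, smul_ite, Finset.sum_ite_eq',
      Finset.mem_univ, if_true, zero_add, add_zero, altForm_apply, heisForm_apply, sub_smul,
      Finset.sum_smul, smul_neg, Finset.sum_neg_distrib, smul_smul]
    rw [add_comm, ← sub_eq_add_neg]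
    simp only [mul_comm]

/-- Integral symplectic reduction: off a maximal hyperbolic family the form must vanish, so pairing
with the family recovers `ω` up to the factor `d`. -/
theorem exists_compat_heisForm [Module.Finite ℤ M] {ω : M →+ M →+ ℤ} (hω : ∀ v, ω v v = 0) :
    ∃ (k : ℕ) (d : ℤ) (u : M →+ (Fin k → ℤ) × (Fin k → ℤ)), HasHyperbolic ω k ∧ d ≠ 0 ∧
      ∀ v w, altForm (heisForm k) (u v) (u w) = d * ω v w := by
  obtain ⟨k, -, hk, hmax⟩ := exists_maximal_hasHyperbolic ω (k := 0)
    ⟨Fin.elim0, Fin.elim0, 1, one_ne_zero, fun i => i.elim0, fun i => i.elim0, fun i => i.elim0⟩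
  obtain ⟨e, f, d, hd, hee, hff, hef⟩ := id hk
  have hanti : ∀ v w, ω v w = -ω w v := by
    intro v w
    have h1 := hω (v + w)
    simp only [map_add, AddMonoidHom.add_apply, hω, add_zero, zero_add] at h1
    linarith
  refine ⟨k, d, AddMonoidHom.mk' (fun v => (fun i => ω v (f i), fun i => ω (e i) v)) ?_, hk, hd, ?_⟩
  · intro v w
    ext i <;> simp
  have hfe : ∀ i j, ω (f i) (e j) = if i = j then -d else 0 := by
    intro i j
    rw [hanti, hef]
    by_cases hij : i = j
    · rw [if_pos hij, if_pos hij.symm]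
    · rw [if_neg hij, if_neg (Ne.symm hij), neg_zero]
  -- This is `d` times the projection to the orthogonal complement of the family; the factor `d`
  -- avoids denominators.
  let p : M → M := fun v => d • v - ∑ i, ω v (f i) • e i - ∑ i, ω (e i) v • f i
  have hpe : ∀ v j, ω (p v) (e j) = 0 := by
    intro v j
    simp only [p, map_sub, AddMonoidHom.sub_apply, map_sum, AddMonoidHom.finsetSum_apply,
      map_zsmul, AddMonoidHom.coe_smul, Pi.smul_apply, hee, hfe, smul_eq_mul, mul_zero,
      Finset.sum_const_zero, mul_ite, Finset.sum_ite_eq', Finset.mem_univ, if_true]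
    rw [hanti v]
    ring
  have hpf : ∀ v j, ω (p v) (f j) = 0 := by
    intro v j
    simp only [p, map_sub, AddMonoidHom.sub_apply, map_sum, AddMonoidHom.finsetSum_apply,
      map_zsmul, AddMonoidHom.coe_smul, Pi.smul_apply, hff, hef, smul_eq_mul, mul_zero,
      Finset.sum_const_zero, mul_ite, Finset.sum_ite_eq', Finset.mem_univ, if_true]
    ring
  have hpp : ∀ v w, ω (p v) (p w) = 0 := by
    intro v w
    by_contra hc
    -- If `p v` and `p w` pair nontrivially they enlarge the family. Rescaling the old `e i` by `ω
    -- (p v) (p w)` and `p w` by `d` makes all diagonal values equal.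
    refine hmax ⟨Fin.cons (p v) fun i => ω (p v) (p w) • e i, Fin.cons (d • p w) f,
      d * ω (p v) (p w), mul_ne_zero hd hc, fun i j => ?_, fun i j => ?_, fun i j => ?_⟩
    · refine Fin.cases ?_ (fun i => ?_) i <;> refine Fin.cases ?_ (fun j => ?_) j <;>
        simp [hω, hpe, hee, hanti (e _) (p v)]
    · refine Fin.cases ?_ (fun i => ?_) i <;> refine Fin.cases ?_ (fun j => ?_) j <;>
        simp [hω, hpf, hff, hanti (f _) (p w)]
    · refine Fin.cases ?_ (fun i => ?_) i <;> refine Fin.cases ?_ (fun j => ?_) j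
      · simp
      · simp [hpf, (Fin.succ_ne_zero j).symm]
      · simp [hanti (e _) (p w), hpe]
      · simp [hef, mul_comm]
  intro v w
  have h1 := hpp v w
  have h2 : ω (p v) (p w) = d * ω (p v) w := by
    conv_lhs => enter [2]; simp only [p]
    simp only [map_sub, map_sum, map_zsmul, hpe, hpf, smul_eq_mul, mul_zero,
      Finset.sum_const_zero, sub_zero]
  rw [h2, mul_eq_zero, or_iff_right hd] at h1
  simp only [p, map_sub, AddMonoidHom.sub_apply, map_sum, AddMonoidHom.finsetSum_apply,
    map_zsmul, AddMonoidHom.coe_smul, Pi.smul_apply, smul_eq_mul, hanti (f _) w, mul_neg,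
    Finset.sum_neg_distrib] at h1
  simp only [altForm_apply, heisForm_apply, AddMonoidHom.mk'_apply, mul_comm (ω w (f _))]
  linarith

theorem altForm_self (β : M →+ M →+ Z) (v : M) : altForm β v v = 0 := by simp

theorem separatedBy_of_hasHyperbolic [IsAddTorsionFree Z] {β : M →+ M →+ Z} {n : ℕ}
    (h : HasHyperbolic (altForm β) n) : SeparatedBy (HeisenbergGroup n) (TwistedProd β) := by
  obtain ⟨u, z, hz, hu⟩ := exists_heisForm_compat_of_hasHyperbolic (altForm_self β) h
  refine TwistedProd.separatedBy (heisForm_nondegenerate n) fun c hc => ⟨_,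
    TwistedProd.homOfCompat_mk_zero_ne_one u (zmultiplesHom Z z) hu ?_⟩
  have : c • z ≠ 0 := fun h0 => (smul_eq_zero.1 h0).elim hc hz
  exact this

/-- Applying `g` to the form reduces to a Heisenberg group of size `k`, and the bound on hyperbolic
families gives `k ≤ n`; the smaller Heisenberg group is in turn separated by the larger one. -/
theorem separatedBy_heisenbergGroup [Module.Finite ℤ M] {β : M →+ M →+ Z} {n : ℕ}
    (hβ : FormNondegenerate (altForm β))
    (h : ∀ z : Z, z ≠ 0 → ∃ g : Z →+ ℤ, g z ≠ 0 ∧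
      ¬ HasHyperbolic ((altForm β).compr₂ g) (n + 1)) :
    SeparatedBy (TwistedProd β) (HeisenbergGroup n) := by
  refine TwistedProd.separatedBy hβ fun z hz => ?_
  obtain ⟨g, hgz, hg⟩ := h z hz
  obtain ⟨k, d, u, hk, hd, hu⟩ := exists_compat_heisForm (ω := (altForm β).compr₂ g)
    fun v => by simp
  have hkn : k ≤ n := by
    by_contra hlt
    exact hg (hk.mono (by omega))
  obtain ⟨ψ, hψ⟩ := separatedBy_of_hasHyperbolic ((hasHyperbolic_heisForm n).mono hkn) _
    (TwistedProd.homOfCompat_mk_zero_ne_one u ((AddMonoidHom.mulLeft d).comp g) hu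
      (mul_ne_zero hd hgz))
  exact ⟨ψ.comp _, hψ⟩

end Hyperbolic

/-! ### The structure of finitely generated torsion-free groups of class two -/

/-- Take for `β` the strictly triangular part of the matrix of `ω` in an ordered basis; no division
by 2 is needed. -/
theorem exists_altForm_eq {ι M Z : Type*} [LinearOrder ι] [AddCommGroup M] [AddCommGroup Z]
    (b : Module.Basis ι ℤ M) (ω : M →+ M →+ Z) (hω : ∀ v, ω v v = 0) :
    ∃ β : M →+ M →+ Z, altForm β = ω := by
  have hanti : ∀ v w, ω v w = -ω w v := by
    intro v w
    have h1 := hω (v + w)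
    simp only [map_add, AddMonoidHom.add_apply, hω, add_zero, zero_add] at h1
    exact eq_neg_of_add_eq_zero_right h1
  let B : M →ₗ[ℤ] M →ₗ[ℤ] Z :=
    b.constr ℤ fun i => b.constr ℤ fun j => if j < i then ω (b i) (b j) else 0
  let W : M →ₗ[ℤ] M →ₗ[ℤ] Z := LinearMap.mk₂ ℤ (fun v w => ω v w)
    (by simp) (by simp) (by simp) (by simp)
  have hB : ∀ i j, B (b i) (b j) = if j < i then ω (b i) (b j) else 0 := by simp [B]
  have hBW : B - B.flip = W := by
    refine LinearMap.ext_basis b b fun i j => ?_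
    simp only [LinearMap.sub_apply, LinearMap.flip_apply, hB, W, LinearMap.mk₂_apply]
    rcases lt_trichotomy i j with h | h | h
    · rw [if_neg h.not_gt, if_pos h, hanti (b i), zero_sub]
    · subst h
      simp [hω]
    · rw [if_pos h, if_neg h.not_gt, sub_zero]
  refine ⟨AddMonoidHom.mk' (fun v => (B v).toAddMonoidHom) fun v w => by ext; simp, ?_⟩
  ext v w
  exact LinearMap.congr_fun₂ hBW v w

section Splitting

variable {G M Z : Type*} [Group G] [AddCommGroup M] [AddCommGroup Z]
  {π : G →* Multiplicative M} {i : Multiplicative Z →* G}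

theorem exists_commutator_form (hπ : Function.Surjective π)
    (hi : Function.Injective i) (hex : π.ker = i.range) (hc : i.range ≤ center G) :
    ∃ ω : M →+ M →+ Z, ∀ g h : G,
      ⁅g, h⁆ = i (Multiplicative.ofAdd (ω (π g).toAdd (π h).toAdd)) := by
  have hmem : ∀ g h : G, ∃ z : Multiplicative Z, i z = ⁅g, h⁆ := fun g h => by
    have : ⁅g, h⁆ ∈ π.ker := by
      rw [MonoidHom.mem_ker, map_commutatorElement, commutatorElement_eq_one_iff_mul_comm, mul_comm]
    rwa [hex] at this
  have hcc : CentralCommutators G := fun g h => by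
    obtain ⟨z, hz⟩ := hmem g h
    exact hc ⟨z, hz⟩
  choose c hcs using hmem
  have hfib : ∀ g g' : G, π g = π g' → ∀ h, c g h = c g' h ∧ c h g = c h g' := by
    intro g g' hgg h
    have h1 : g'⁻¹ * g ∈ center G := hc (hex ▸ by simp [MonoidHom.mem_ker, hgg])
    have h2 : g = g' * (g'⁻¹ * g) := by group
    constructor <;> apply hi <;> rw [hcs, hcs, h2]
    · rw [hcc.mul_left, commutatorElement_eq_one_iff_mul_comm.2 (mem_center_iff.1 h1 h).symm,
        mul_one]
    · rw [hcc.mul_right, commutatorElement_eq_one_iff_mul_comm.2 (mem_center_iff.1 h1 h), mul_one]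
  let s : M → G := fun v => Function.surjInv hπ (Multiplicative.ofAdd v)
  have hs : ∀ v, π (s v) = Multiplicative.ofAdd v := fun v => Function.surjInv_eq hπ _
  refine ⟨AddMonoidHom.mk' (fun v => AddMonoidHom.mk' (fun w => (c (s v) (s w)).toAdd) ?_) ?_, ?_⟩
  · intro w x
    rw [← toAdd_mul]
    congr 1
    rw [(hfib _ (s w * s x) (by simp [hs]) (s v)).2]
    apply hi
    rw [map_mul, hcs, hcs, hcs, hcc.mul_right]
  · intro v w
    ext x
    simp only [AddMonoidHom.mk'_apply, AddMonoidHom.add_apply]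
    rw [← toAdd_mul]
    congr 1
    rw [(hfib _ (s v * s w) (by simp [hs]) (s x)).1]
    apply hi
    rw [map_mul, hcs, hcs, hcs, hcc.mul_left]
  · intro g h
    simp only [AddMonoidHom.mk'_apply, ofAdd_toAdd]
    rw [(hfib _ g (by simp [hs]) _).1, (hfib _ h (by simp [hs]) _).2, hcs]

/-- The abelian group structure on a central extension of `M` by `Z` obtained by dividing the
multiplication by a biadditive cocycle with the same commutator form. -/
@[reducible]
def untwist (hc : i.range ≤ center G) (β : M →+ M →+ Z)
    (hβ : ∀ g h : G, ⁅g, h⁆ = i (Multiplicative.ofAdd (altForm β (π g).toAdd (π h).toAdd)))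
    (hπi : ∀ z, π (i z) = 1) : AddCommGroup G :=
  have hcomm : ∀ z g, i z * g = g * i z := fun z g => (mem_center_iff.1 (hc ⟨z, rfl⟩) g).symm
  letI : Add G := ⟨fun g h => g * h * i (Multiplicative.ofAdd (-β (π g).toAdd (π h).toAdd))⟩
  letI : Zero G := ⟨1⟩
  letI : Neg G := ⟨fun g => g⁻¹ * i (Multiplicative.ofAdd (-β (π g).toAdd (π g).toAdd))⟩
  have hadd : ∀ g h : G,
      g + h = g * h * i (Multiplicative.ofAdd (-β (π g).toAdd (π h).toAdd)) := fun _ _ => rfl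
  have hzero : (0 : G) = 1 := rfl
  have hneg : ∀ g : G,
      -g = g⁻¹ * i (Multiplicative.ofAdd (-β (π g).toAdd (π g).toAdd)) := fun _ => rfl
  have hadd_comm : ∀ a b : G, a + b = b + a := by
    intro a b
    have h1 : a * b = ⁅a, b⁆ * (b * a) := by rw [commutatorElement_def]; group
    rw [hadd, hadd, h1, hβ, hcomm, mul_assoc, ← map_mul, ← ofAdd_add]
    congr 3
    rw [altForm_apply]
    abel
  { AddGroup.ofLeftAxioms
    (by
      intro a b c
      simp only [hadd, map_mul, hπi, mul_one, toAdd_mul, map_add, AddMonoidHom.add_apply]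
      rw [mul_assoc (a * b), hcomm _ c]
      simp only [mul_assoc, ← map_mul, ← ofAdd_add]
      congr 5
      abel)
    (by
      intro a
      simp [hadd, hzero])
    (by
      intro a
      rw [hneg]
      simp only [hadd, hzero, map_mul, hπi, mul_one]
      rw [mul_assoc a⁻¹, hcomm, inv_mul_cancel_left, ← map_mul i, ← ofAdd_add]
      simp) with
    add_comm := hadd_comm }

theorem exists_mulEquiv_twistedProd {ι : Type*} [LinearOrder ι] (b : Module.Basis ι ℤ M)
    (hπ : Function.Surjective π)
    (hi : Function.Injective i) (hex : π.ker = i.range) (hc : i.range ≤ center G) :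
    ∃ (β : M →+ M →+ Z) (e : TwistedProd β ≃* G),
      ∀ z, e ⟨0, z⟩ = i (Multiplicative.ofAdd z) := by
  obtain ⟨ω, hω⟩ := exists_commutator_form hπ hi hex hc
  obtain ⟨β, rfl⟩ := exists_altForm_eq b ω (by
    intro v
    obtain ⟨g, hg⟩ := hπ (Multiplicative.ofAdd v)
    have h1 := hω g g
    rw [commutatorElement_self, hg] at h1
    exact Multiplicative.ofAdd.injective (hi (h1.symm.trans (map_one i).symm)))
  have hπi : ∀ z, π (i z) = 1 := fun z => by
    have : i z ∈ π.ker := hex ▸ ⟨z, rfl⟩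
    exact this
  -- In the untwisted abelian structure the projection to the free group `M` splits; the additive
  -- section `s` is multiplicative in `G` up to exactly the cocycle `β`.
  let _ := untwist hc β hω hπi
  let p : G →+ M := AddMonoidHom.mk' (fun g => (π g).toAdd) (by
    intro g h
    change (π (g * h * i _)).toAdd = _
    rw [map_mul π, map_mul π, hπi, mul_one, toAdd_mul])
  let s : M →ₗ[ℤ] G := b.constr ℤ fun j => Function.surjInv hπ (Multiplicative.ofAdd (b j))
  have hps : ∀ v, π (s v) = Multiplicative.ofAdd v := by
    have h1 : p.toIntLinearMap ∘ₗ s = LinearMap.id := b.ext fun j => by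
      simp only [LinearMap.comp_apply, s, Module.Basis.constr_basis]
      exact congrArg Multiplicative.toAdd (Function.surjInv_eq hπ _)
    exact fun v => congrArg Multiplicative.ofAdd (LinearMap.congr_fun h1 v)
  have hs0 : s 0 = (1 : G) := map_zero s
  have hcomm : ∀ z g, i z * g = g * i z := fun z g => (mem_center_iff.1 (hc ⟨z, rfl⟩) g).symm
  have hsadd : ∀ v w, s v * s w = s (v + w) * i (Multiplicative.ofAdd (β v w)) := by
    intro v w
    have h1 : s (v + w) =
        s v * s w * i (Multiplicative.ofAdd (-β (π (s v)).toAdd (π (s w)).toAdd)) :=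
      map_add s v w
    rw [h1, hps, hps, mul_assoc, ← map_mul i, ← ofAdd_add]
    simp
  let φ : TwistedProd β →* G :=
      MonoidHom.mk' (fun x => s x.fst * i (Multiplicative.ofAdd x.snd)) (by
    intro x y
    rw [mul_assoc (s x.fst), ← mul_assoc _ (s y.fst), hcomm, mul_assoc, ← mul_assoc (s x.fst),
      ← map_mul i, hsadd, mul_assoc, ← map_mul i, ← ofAdd_add, ← ofAdd_add, TwistedProd.fst_mul,
      TwistedProd.snd_mul, add_comm (β _ _)])
  have hπφ : ∀ x, π (φ x) = Multiplicative.ofAdd x.fst := fun x => by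
    change π (s x.fst * i _) = _
    rw [map_mul, hπi, mul_one, hps]
  have hφ0 : ∀ z, φ ⟨0, z⟩ = i (Multiplicative.ofAdd z) := fun z => by
    change s 0 * i _ = _
    rw [hs0, one_mul]
  refine ⟨β, MulEquiv.ofBijective φ ⟨(injective_iff_map_eq_one φ).2 fun x hx => ?_, fun g => ?_⟩,
    hφ0⟩
  · have h1 : x.fst = 0 := by
      have := hπφ x
      rw [hx, map_one] at this
      exact (Multiplicative.ofAdd.injective this).symm
    have h2 : x = ⟨0, x.snd⟩ := TwistedProd.ext h1 rfl
    rw [h2, hφ0] at hx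
    rw [h2, TwistedProd.mk_zero_eq_one]
    exact Multiplicative.ofAdd.injective (hi (hx.trans (map_one i).symm))
  · have h1 : (s (π g).toAdd)⁻¹ * g ∈ i.range := hex ▸ by simp [MonoidHom.mem_ker, hps]
    obtain ⟨z, hz⟩ := h1
    refine ⟨⟨(π g).toAdd, z.toAdd⟩, ?_⟩
    change s _ * i z = g
    rw [hz, mul_inv_cancel_left]

end Splitting

/-! ### Finite generation of the centre and the normal form of the groups -/

theorem IsFGTorsionFreeClassTwo.centralCommutators {G : Type*} [Group G]
    (h : IsFGTorsionFreeClassTwo G) : CentralCommutators G := by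
  have := h.nilpotent
  intro a b
  rw [← Subgroup.upperCentralSeries_one]
  refine Subgroup.mem_upperCentralSeries_succ_iff.1 ?_ b
  rw [Subgroup.upperCentralSeries_eq_top_iff_nilpotencyClass_le.2 h.classTwo.le]
  exact Subgroup.mem_top a

theorem fg_of_commGroup {A : Type*} [CommGroup A] [Group.FG A] (H : Subgroup A) : H.FG := by
  have : Module.Finite ℤ (Additive A) := Module.Finite.iff_addGroup_fg.2 inferInstance
  rw [Subgroup.fg_iff_add_fg, ← AddSubgroup.toIntSubmodule_toAddSubgroup H.toAddSubgroup,
    ← Submodule.fg_iff_addSubgroup_fg]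
  exact IsNoetherian.noetherian _

/-- Commutators of generators generate a central subgroup `K` containing all commutators. The image
of the centre in the finitely generated abelian group `G ⧸ K` is finitely generated, and lifts of
its generators together with `K` generate the centre. -/
theorem CentralCommutators.fg_center {G : Type*} [Group G] [hG : Group.FG G]
    (h : CentralCommutators G) : (center G).FG := by
  obtain ⟨S, hS, hfin⟩ := Group.fg_iff.1 hG
  let K : Subgroup G := Subgroup.closure (Set.image2 (fun s t : G => ⁅s, t⁆) S S)
  have hKc : K ≤ center G := (Subgroup.closure_le _).2 (by
    rintro _ ⟨s, _, t, _, rfl⟩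
    exact h s t)
  have hKfg : K.FG := (Subgroup.fg_iff _).2 ⟨_, rfl, hfin.image2 _ hfin⟩
  have hright : ∀ s ∈ S, ∀ b : G, ⁅s, b⁆ ∈ K := by
    intro s hs
    let φ : G →* G := ⟨⟨fun b : G => ⁅s, b⁆, commutatorElement_one_right s⟩, h.mul_right s⟩
    have : Subgroup.closure S ≤ K.comap φ := (Subgroup.closure_le _).2 fun t ht =>
      Subgroup.subset_closure ⟨s, hs, t, ht, rfl⟩
    exact fun b => this (hS ▸ Subgroup.mem_top b)
  have hK : ∀ a b : G, ⁅a, b⁆ ∈ K := by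
    intro a b
    let φ : G →* G := ⟨⟨fun a => ⁅a, b⁆, commutatorElement_one_left b⟩, fun a c => h.mul_left a c b⟩
    have : Subgroup.closure S ≤ K.comap φ := (Subgroup.closure_le _).2 fun s hs => hright s hs b
    exact this (hS ▸ Subgroup.mem_top a)
  have hnormal : K.Normal := ⟨fun x hx g => by
    rwa [mem_center_iff.1 (hKc hx) g, mul_inv_cancel_right]⟩
  let _ : CommGroup (G ⧸ K) :=
    { (inferInstance : Group (G ⧸ K)) with
      mul_comm := by
        intro x y
        obtain ⟨a, rfl⟩ := QuotientGroup.mk_surjective x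
        obtain ⟨b, rfl⟩ := QuotientGroup.mk_surjective y
        rw [← commutatorElement_eq_one_iff_mul_comm]
        exact (QuotientGroup.eq_one_iff _).2 (hK a b) }
  have hfgK : Group.FG (G ⧸ K) := inferInstance
  obtain ⟨T, hT, hTfin⟩ := (Subgroup.fg_iff _).1
    (fg_of_commGroup ((center G).map (QuotientGroup.mk' K)))
  have hTmem : ∀ t ∈ T, ∃ g ∈ center G, (g : G ⧸ K) = t := fun t ht => by
    have : t ∈ (center G).map (QuotientGroup.mk' K) := hT ▸ Subgroup.subset_closure ht
    exact this
  choose! r hrc hr using hTmem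
  have hT' : (Subgroup.closure (r '' T)).FG := (Subgroup.fg_iff _).2 ⟨_, rfl, hTfin.image r⟩
  convert hKfg.sup hT'
  apply le_antisymm
  · intro x hx
    have h1 : (Subgroup.closure (r '' T)).map (QuotientGroup.mk' K) =
        (center G).map (QuotientGroup.mk' K) := by
      rw [MonoidHom.map_closure, Set.image_image, ← hT]
      exact congrArg Subgroup.closure ((Set.image_congr hr).trans (Set.image_id T))
    obtain ⟨y, hy, hyx⟩ := (h1.symm ▸ ⟨x, hx, rfl⟩ :
      QuotientGroup.mk' K x ∈ (Subgroup.closure (r '' T)).map (QuotientGroup.mk' K))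
    have h2 : y⁻¹ * x ∈ K := QuotientGroup.eq.1 hyx
    rw [← mul_inv_cancel_left y x]
    exact mul_mem (mem_sup_right hy) (mem_sup_left h2)
  · exact sup_le hKc ((Subgroup.closure_le _).2 (by
      rintro _ ⟨t, ht, rfl⟩
      exact hrc t ht))

theorem TorsionFree.exists_basis {A : Type*} [CommGroup A] [Group.FG A] (h : TorsionFree A) :
    Nonempty (Module.Basis (Fin (Module.finrank ℤ (Additive A))) ℤ (Additive A)) := by
  have : Module.Finite ℤ (Additive A) := Module.Finite.iff_addGroup_fg.2 inferInstance
  have : IsMulTorsionFree A := ⟨fun n hn x y hxy => by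
    rw [← div_eq_one]
    refine h.eq_one_of_pow (Nat.pos_of_ne_zero hn) ?_
    rw [div_pow, div_eq_one]
    exact hxy⟩
  have : Module.IsTorsionFree ℤ (Additive A) :=
    Module.isTorsionFree_int_iff_isAddTorsionFree.2 inferInstance
  have : Module.Free ℤ (Additive A) := inferInstance
  exact ⟨Module.finBasis ℤ (Additive A)⟩

open scoped IsMulCommutative in
theorem IsFGTorsionFreeClassTwo.exists_mulEquiv {G : Type*} [Group G]
    (h : IsFGTorsionFreeClassTwo G) {r : ℕ} (hr : centerRank G = r) :
    ∃ (m : ℕ) (β : (Fin m → ℤ) →+ (Fin m → ℤ) →+ (Fin r → ℤ)),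
      FormNondegenerate (altForm β) ∧ (∃ v w, altForm β v w ≠ 0) ∧
        Nonempty (TwistedProd β ≃* G) := by
  subst hr
  have := h.nilpotent
  have := h.fg
  have hcc := h.centralCommutators
  let _ : CommGroup (G ⧸ center G) :=
    { (inferInstance : Group (G ⧸ center G)) with
      mul_comm := by
        intro x y
        obtain ⟨a, rfl⟩ := QuotientGroup.mk_surjective x
        obtain ⟨b, rfl⟩ := QuotientGroup.mk_surjective y
        rw [← commutatorElement_eq_one_iff_mul_comm]
        exact (QuotientGroup.eq_one_iff _).2 (hcc a b) }
  have hfgq : Group.FG (G ⧸ center G) := inferInstance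
  have hfgc : Group.FG (center G) := (Group.fg_iff_subgroup_fg _).2 hcc.fg_center
  obtain ⟨bM⟩ := h.torsionFree.quotient_center.exists_basis
  obtain ⟨bZ⟩ : Nonempty (Module.Basis (Fin (centerRank G)) ℤ (Additive (center G))) :=
    (h.torsionFree.of_injective (center G).subtype (center G).subtype_injective).exists_basis
  let eM := bM.equivFun
  let eZ := bZ.equivFun
  let π : G →* Multiplicative (Fin (Module.finrank ℤ (Additive (G ⧸ center G))) → ℤ) :=
    MonoidHom.mk' (fun g => Multiplicative.ofAdd (eM (Additive.ofMul (g : G ⧸ center G))))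
      fun a b => by rw [QuotientGroup.mk_mul, ofMul_mul, map_add, ofAdd_add]
  let i : Multiplicative (Fin (centerRank G) → ℤ) →* G :=
    MonoidHom.mk' (fun z => ((eZ.symm z.toAdd).toMul : center G))
      fun a b => by rw [toAdd_mul, map_add, toMul_add, Subgroup.coe_mul]
  have hker : π.ker = center G := by
    ext g
    rw [MonoidHom.mem_ker, ← QuotientGroup.eq_one_iff]
    exact eM.map_eq_zero_iff
  have hrange : i.range = center G := by
    ext g
    constructor
    · rintro ⟨z, rfl⟩
      exact Subtype.prop _
    · intro hg
      refine ⟨Multiplicative.ofAdd (eZ (Additive.ofMul ⟨g, hg⟩)), ?_⟩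
      change ((eZ.symm (eZ _)).toMul : center G).1 = g
      rw [eZ.symm_apply_apply]
      rfl
  have hπ : Function.Surjective π := by
    intro v
    obtain ⟨g, hg⟩ := QuotientGroup.mk_surjective (eM.symm v.toAdd).toMul
    refine ⟨g, ?_⟩
    change Multiplicative.ofAdd (eM (Additive.ofMul (g : G ⧸ center G))) = v
    rw [hg]
    exact eM.apply_symm_apply _
  have hi : Function.Injective i := fun a b hab =>
    eZ.symm.injective (Additive.toMul.injective (Subtype.ext hab))
  obtain ⟨β, e, he⟩ := exists_mulEquiv_twistedProd (Pi.basisFun ℤ _) hπ hi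
    (hker.trans hrange.symm) hrange.le
  refine ⟨_, β, fun v hv => ?_, ?_, ⟨e⟩⟩
  · have h1 : (⟨v, 0⟩ : TwistedProd β) ∈ center (TwistedProd β) := mem_center_iff.2 fun x => by
      rw [← commutatorElement_eq_one_iff_mul_comm, ← commutatorElement_inv, inv_eq_one,
        TwistedProd.commutator_eq, hv]
      rfl
    have h2 : e ⟨v, 0⟩ ∈ i.range := hrange.ge <| mem_center_iff.2 fun g => by
      have := congrArg e (mem_center_iff.1 h1 (e.symm g))
      rwa [map_mul, map_mul, e.apply_symm_apply] at this
    obtain ⟨z, hz⟩ := h2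
    exact congrArg TwistedProd.fst (e.injective (hz.symm.trans (he z.toAdd).symm))
  · by_contra! hcon
    have h1 : IsMulCommutative G := ⟨⟨fun a b => by
      rw [← commutatorElement_eq_one_iff_mul_comm]
      apply e.symm.injective
      rw [map_commutatorElement, TwistedProd.commutator_eq, hcon, map_one]
      rfl⟩⟩
    have h2 := Group.IsNilpotent.nilpotencyClass_le_one_iff.2 h1
    rw [h.classTwo] at h2
    omega

/-! ### Groups with isomorphic Mal'tsev completions -/

open scoped IsMulCommutative in
theorem IsMalcevCompletion.separatedBy {m₁ m₂ r₁ r₂ : ℕ}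
    {β₁ : (Fin m₁ → ℤ) →+ (Fin m₁ → ℤ) →+ (Fin r₁ → ℤ)}
    {β₂ : (Fin m₂ → ℤ) →+ (Fin m₂ → ℤ) →+ (Fin r₂ → ℤ)}
    (hβ₁ : FormNondegenerate (altForm β₁)) (hβ₂ : FormNondegenerate (altForm β₂))
    {D : Type*} [Group D] {ι : TwistedProd β₁ →* D} {κ : TwistedProd β₂ →* D}
    (hι : IsMalcevCompletion ι) (hκ : IsMalcevCompletion κ) :
    SeparatedBy (TwistedProd β₁) (TwistedProd β₂) := by
  have hD := hι.centralCommutators TwistedProd.centralCommutators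
  have hpow : ∀ {k : ℕ} (x : Fin k → TwistedProd β₁),
      ∃ n : ℕ, 0 < n ∧ ∀ i, ι (x i) ^ n ∈ κ.range := by
    intro k x
    choose n hn hx using fun i => hκ.exists_pow_mem_range TwistedProd.centralCommutators (ι (x i))
    refine ⟨∏ i, n i, Finset.prod_pos fun i _ => hn i, fun i => ?_⟩
    obtain ⟨c, hc⟩ := Finset.dvd_prod_of_mem n (Finset.mem_univ i)
    rw [hc, pow_mul]
    exact pow_mem (hx i) c
  obtain ⟨n₁, hn₁, ha⟩ := hpow fun i => (⟨Pi.single i 1, 0⟩ : TwistedProd β₁)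
  obtain ⟨n₂, hn₂, hb⟩ := hpow fun i => (⟨0, Pi.single i 1⟩ : TwistedProd β₁)
  -- One exponent `K` moves all basis elements of both layers of the first group into the image of
  -- the second.
  obtain ⟨K, hK, ha', hb'⟩ : ∃ K : ℕ, 0 < K ∧
      (∀ i, ∃ a, κ a = ι ⟨Pi.single i 1, 0⟩ ^ K) ∧ ∀ i, ∃ b, κ b = ι ⟨0, Pi.single i 1⟩ ^ K := by
    refine ⟨n₁ * n₂, Nat.mul_pos hn₁ hn₂, fun i => ?_, fun i => ?_⟩
    · rw [pow_mul]
      exact pow_mem (ha i) n₂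
    · rw [mul_comm, pow_mul]
      exact pow_mem (hb i) n₁
  choose a ha using ha'
  choose b hb using hb'
  have hbfst : ∀ i, (b i).fst = 0 := by
    intro i
    rw [← TwistedProd.mem_center hβ₂]
    refine mem_center_iff.2 fun g => hκ.injective ?_
    have h1 : κ (b i) ∈ center D := by
      rw [hb]
      exact pow_mem (hι.map_mem_center (TwistedProd.mk_zero_mem_center _)) K
    rw [map_mul, map_mul, mem_center_iff.1 h1]
  let j₁ : (Fin r₁ → ℤ) →ₗ[ℤ] Additive (center D) :=
    (AddMonoidHom.mk' (fun z => Additive.ofMul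
      ⟨ι ⟨0, z⟩, hι.map_mem_center (TwistedProd.mk_zero_mem_center z)⟩) (fun y z =>
        Additive.toMul.injective (Subtype.ext
          (map_mul (ι.comp (TwistedProd.inr β₁)) (Multiplicative.ofAdd y)
            (Multiplicative.ofAdd z))))).toIntLinearMap
  let j₂ : (Fin r₂ → ℤ) →ₗ[ℤ] Additive (center D) :=
    (AddMonoidHom.mk' (fun z => Additive.ofMul
      ⟨κ ⟨0, z⟩, hκ.map_mem_center (TwistedProd.mk_zero_mem_center z)⟩) (fun y z =>
        Additive.toMul.injective (Subtype.ext
          (map_mul (κ.comp (TwistedProd.inr β₂)) (Multiplicative.ofAdd y)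
            (Multiplicative.ofAdd z))))).toIntLinearMap
  have hj₁ : ∀ (z) (n : ℕ), ((n • j₁ z).toMul : center D).1 = ι ⟨0, z⟩ ^ n := fun _ _ => rfl
  have hj₂ : ∀ z, ((j₂ z).toMul : center D).1 = κ ⟨0, z⟩ := fun _ => rfl
  have hj₂inj : Function.Injective j₂ := fun y z hyz =>
    congrArg TwistedProd.snd
      (hκ.injective (congrArg (fun t => ((Additive.toMul t : center D)).1) hyz))
  let u : (Fin m₁ → ℤ) →ₗ[ℤ] (Fin m₂ → ℤ) := (Pi.basisFun ℤ (Fin m₁)).constr ℤ fun i => (a i).fst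
  let h : (Fin r₁ → ℤ) →ₗ[ℤ] (Fin r₂ → ℤ) := (Pi.basisFun ℤ (Fin r₁)).constr ℤ fun i => (b i).snd
  have hu : ∀ i, u (Pi.basisFun ℤ (Fin m₁) i) = (a i).fst := fun i => Module.Basis.constr_basis ..
  have hh : ∀ i, h (Pi.basisFun ℤ (Fin r₁) i) = (b i).snd := fun i => Module.Basis.constr_basis ..
  have hjh : ∀ z, j₂ (h z) = K • j₁ z := by
    have : j₂ ∘ₗ h = K • j₁ := (Pi.basisFun ℤ (Fin r₁)).ext fun i => by
      refine Additive.toMul.injective (Subtype.ext ?_)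
      rw [LinearMap.comp_apply, LinearMap.smul_apply, hj₂, hj₁, hh, Pi.basisFun_apply, ← hb]
      exact congrArg κ (TwistedProd.ext (hbfst i).symm rfl)
    exact LinearMap.congr_fun this
  let L : (Fin m₁ → ℤ) →ₗ[ℤ] (Fin m₁ → ℤ) →ₗ[ℤ] Additive (center D) :=
    LinearMap.mk₂ ℤ (fun v w => j₂ (altForm β₂ (u v) (u w))) (by simp [-altForm_apply])
      (by simp [-altForm_apply, -zsmul_eq_mul]) (by simp [-altForm_apply])
      (by simp [-altForm_apply, -zsmul_eq_mul])
  let R : (Fin m₁ → ℤ) →ₗ[ℤ] (Fin m₁ → ℤ) →ₗ[ℤ] Additive (center D) :=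
    LinearMap.mk₂ ℤ (fun v w => j₁ (altForm β₁ v w)) (by simp [-altForm_apply])
      (by simp [-altForm_apply, -zsmul_eq_mul]) (by simp [-altForm_apply])
      (by simp [-altForm_apply, -zsmul_eq_mul])
  -- On basis vectors this is `⁅x ^ K, y ^ K⁆ = ⁅x, y⁆ ^ (K * K)` in `D`. Since `h` already accounts
  -- for one factor `K`, the map compatible with `u` is `K • h`.
  have hLR : L = (K * K) • R := by
    refine LinearMap.ext_basis (Pi.basisFun ℤ _) (Pi.basisFun ℤ _) fun i j => ?_
    refine Additive.toMul.injective (Subtype.ext ?_)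
    simp only [L, R, LinearMap.smul_apply, LinearMap.mk₂_apply]
    rw [hj₂, hj₁, hu, hu, ← TwistedProd.commutator_eq, map_commutatorElement, ha, ha, hD.pow_left,
      hD.pow_right, ← map_commutatorElement, TwistedProd.commutator_eq, pow_mul, Pi.basisFun_apply,
      Pi.basisFun_apply]
  have hcompat : ∀ v w, altForm β₂ (u.toAddMonoidHom v) (u.toAddMonoidHom w) =
      (K • h.toAddMonoidHom) (altForm β₁ v w) := by
    intro v w
    apply hj₂inj
    refine (LinearMap.congr_fun₂ hLR v w).trans ?_
    change (K * K) • j₁ _ = j₂ (K • h _)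
    rw [map_nsmul, hjh, mul_smul]
  refine TwistedProd.separatedBy hβ₁ fun z hz => ⟨_,
    TwistedProd.homOfCompat_mk_zero_ne_one _ _ hcompat fun h0 => hz ?_⟩
  have h1 : j₂ (K • h z) = 0 := by
    rw [show K • h z = 0 from h0, map_zero]
  rw [map_nsmul, hjh, ← mul_smul] at h1
  have h2 : ι ⟨0, z⟩ ^ (K * K) = 1 :=
    congrArg (fun t => ((Additive.toMul t : center D)).1) h1
  have h3 := hι.torsionFree.eq_one_of_pow (Nat.mul_pos hK hK) h2
  rw [← map_one ι] at h3
  exact congrArg TwistedProd.snd (hι.injective h3)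

/-! ### The Mal'tsev completion of a central extension -/

/-- Multiplication by denominators. -/
theorem exists_nsmul_eq_intCast {k : ℕ} (x : Fin k → ℚ) :
    ∃ n : ℕ, 0 < n ∧ ∃ y : Fin k → ℤ, n • x = (Int.castAddHom ℚ).compLeft (Fin k) y := by
  refine ⟨∏ i, (x i).den, Finset.prod_pos fun i _ => (x i).den_pos, ?_⟩
  have h1 : ∀ i, ∃ y : ℤ, ((∏ i, (x i).den : ℕ) : ℚ) * x i = y := by
    intro i
    obtain ⟨c, hc⟩ := Finset.dvd_prod_of_mem (fun i => (x i).den) (Finset.mem_univ i)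
    refine ⟨(x i).num * c, ?_⟩
    rw [hc]
    push_cast
    rw [mul_right_comm, mul_comm _ (x i), Rat.mul_den_eq_num]
  choose y hy using h1
  refine ⟨y, funext fun i => ?_⟩
  rw [Pi.smul_apply, nsmul_eq_mul, hy]
  rfl

theorem exists_ratForm {m r : ℕ} (β : (Fin m → ℤ) →+ (Fin m → ℤ) →+ (Fin r → ℤ)) :
    ∃ B : (Fin m → ℚ) →+ (Fin m → ℚ) →+ (Fin r → ℚ), ∀ v w,
      B ((Int.castAddHom ℚ).compLeft (Fin m) v) ((Int.castAddHom ℚ).compLeft (Fin m) w) =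
        (Int.castAddHom ℚ).compLeft (Fin r) (β v w) := by
  let c : ∀ k : ℕ, (Fin k → ℤ) →+ (Fin k → ℚ) := fun k => (Int.castAddHom ℚ).compLeft (Fin k)
  let B : (Fin m → ℚ) →ₗ[ℚ] (Fin m → ℚ) →ₗ[ℚ] (Fin r → ℚ) :=
    (Pi.basisFun ℚ (Fin m)).constr ℚ fun i => (Pi.basisFun ℚ (Fin m)).constr ℚ fun j =>
      c r (β (Pi.single i 1) (Pi.single j 1))
  have hc : ∀ i : Fin m, c m (Pi.basisFun ℤ (Fin m) i) = Pi.basisFun ℚ (Fin m) i := by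
    intro i
    ext j
    simp [c, Pi.single_apply]
  let L : (Fin m → ℤ) →ₗ[ℤ] (Fin m → ℤ) →ₗ[ℤ] (Fin r → ℚ) :=
    LinearMap.mk₂ ℤ (fun v w => B (c m v) (c m w)) (by simp)
      (by simp [-zsmul_eq_mul]) (by simp) (by simp [-zsmul_eq_mul])
  let R : (Fin m → ℤ) →ₗ[ℤ] (Fin m → ℤ) →ₗ[ℤ] (Fin r → ℚ) :=
    LinearMap.mk₂ ℤ (fun v w => c r (β v w)) (by simp)
      (by simp [-zsmul_eq_mul]) (by simp) (by simp [-zsmul_eq_mul])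
  have hLR : L = R := by
    refine LinearMap.ext_basis (Pi.basisFun ℤ _) (Pi.basisFun ℤ _) fun i j => ?_
    simp only [L, R, LinearMap.mk₂_apply]
    rw [hc, hc]
    simp [B]
  refine ⟨AddMonoidHom.mk' (fun v => (B v).toAddMonoidHom) fun v w => by ext; simp, ?_⟩
  exact fun v w => LinearMap.congr_fun₂ hLR v w

theorem TwistedProd.isComplete_top {M Z : Type*} [AddCommGroup M] [AddCommGroup Z] [Module ℚ M]
    [Module ℚ Z] (B : M →+ M →+ Z) : IsComplete (⊤ : Subgroup (TwistedProd B)) := by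
  intro x _ n hn
  have hn' : (n : ℚ) ≠ 0 := by exact_mod_cast hn.ne'
  have key : ∀ {A : Type _} [AddCommGroup A] [Module ℚ A] (a : A), n • (n : ℚ)⁻¹ • a = a := by
    intro A _ _ a
    rw [← Nat.cast_smul_eq_nsmul ℚ, smul_smul, mul_inv_cancel₀ hn', one_smul]
  let v := (n : ℚ)⁻¹ • x.fst
  -- The second component solves the power formula `snd_pow` for an `n`-th root.
  refine ⟨⟨v, (n : ℚ)⁻¹ • (x.snd - n.choose 2 • B v v)⟩, Subgroup.mem_top _, ?_⟩
  have hv : n • v = x.fst := by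
    simp only [v]
    rw [← Nat.cast_smul_eq_nsmul ℚ, smul_smul, mul_inv_cancel₀ hn', one_smul]
  ext
  · rw [fst_pow, hv]
  · rw [snd_pow, key, sub_add_cancel]

/-- An integral central extension has a Mal'tsev completion; it is also one of every group that
embeds in the extension in such a way that each element has a power in the image. -/
theorem exists_isMalcevCompletion {m r : ℕ} (β : (Fin m → ℤ) →+ (Fin m → ℤ) →+ (Fin r → ℤ)) :
    ∃ (D : Type) (_ : Group D) (ι : TwistedProd β →* D), ∀ {G : Type} [Group G]
      (φ : G →* TwistedProd β), Function.Injective φ →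
      (∀ x, ∃ n : ℕ, 0 < n ∧ x ^ n ∈ φ.range) → IsMalcevCompletion (ι.comp φ) := by
  obtain ⟨B, hB⟩ := exists_ratForm β
  let c : ∀ k : ℕ, (Fin k → ℤ) →+ (Fin k → ℚ) := fun k => (Int.castAddHom ℚ).compLeft (Fin k)
  have hcinj : ∀ {k : ℕ} {x y : Fin k → ℤ}, c k x = c k y → x = y := fun h =>
    funext fun i => Int.cast_injective (congrFun h i)
  let ι : TwistedProd β →* TwistedProd B :=
    MonoidHom.mk' (fun x => ⟨c m x.fst, c r x.snd⟩) fun x y => by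
      ext1
      · simp
      · simp only [TwistedProd.snd_mul, map_add]
        rw [hB]
  have hιinj : Function.Injective ι := fun x y hxy =>
    TwistedProd.ext (hcinj (congrArg TwistedProd.fst hxy)) (hcinj (congrArg TwistedProd.snd hxy))
  have hιpow : ∀ d : TwistedProd B, ∃ n : ℕ, 0 < n ∧ d ^ n ∈ ι.range := by
    intro d
    obtain ⟨n₁, hn₁, y₁, hy₁⟩ := exists_nsmul_eq_intCast d.fst
    obtain ⟨n₂, hn₂, y₂, hy₂⟩ := exists_nsmul_eq_intCast d.snd
    obtain ⟨n₃, hn₃, y₃, hy₃⟩ := exists_nsmul_eq_intCast (B d.fst d.fst)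
    -- The factor 2 keeps the binomial coefficient divisible by `n₃`, which clears the denominators
    -- of `B d.fst d.fst`.
    have hc : (2 * (n₁ * n₂ * n₃)).choose 2 =
        (n₁ * n₂ * (2 * (n₁ * n₂ * n₃) - 1)) * n₃ := by
      rw [Nat.choose_two_right, mul_assoc, Nat.mul_div_cancel_left _ two_pos]
      ring
    refine ⟨2 * (n₁ * n₂ * n₃), by positivity, ⟨(2 * n₂ * n₃) • y₁, (2 * n₁ * n₃) • y₂ +
      (n₁ * n₂ * (2 * (n₁ * n₂ * n₃) - 1)) • y₃⟩, TwistedProd.ext ?_ ?_⟩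
    · have h1 : 2 * (n₁ * n₂ * n₃) = (2 * n₂ * n₃) * n₁ := by ring
      rw [TwistedProd.fst_pow, h1, mul_smul _ n₁ d.fst, hy₁]
      exact map_nsmul (c m) _ _
    · have h1 : (2 * (n₁ * n₂ * n₃)) • d.snd = (2 * n₁ * n₃) • n₂ • d.snd := by
        rw [← mul_smul]
        congr 1
        ring
      rw [TwistedProd.snd_pow, hc, mul_smul _ n₃ (B d.fst d.fst), hy₃, h1, hy₂]
      exact (map_add (c r) _ _).trans (by rw [map_nsmul, map_nsmul])
  refine ⟨TwistedProd B, inferInstance, ι, fun {G} _ φ hφ hpow => ?_⟩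
  have := TwistedProd.isNilpotent (β := B)
  refine IsMalcevCompletion.of_exists_pow_mem_range (hιinj.comp hφ) TwistedProd.torsionFree
    (TwistedProd.isComplete_top B) fun d => ?_
  obtain ⟨n, hn, x, hx⟩ := hιpow d
  obtain ⟨k, hk, g, hg⟩ := hpow x
  refine ⟨n * k, Nat.mul_pos hn hk, g, ?_⟩
  rw [pow_mul, ← hx, MonoidHom.comp_apply, hg, map_pow]

/-! ### Comparison with Heisenberg groups -/

/-- The kernel of a nonzero functional on `ℤ²` has rank 1: a nonzero determinant of `y₀` and `y`
would force both coefficients of `f` to vanish. -/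
theorem exists_smul_eq_smul_of_map_eq_zero {f : (Fin 2 → ℤ) →+ ℤ} (hf : f ≠ 0) {y y₀ : Fin 2 → ℤ}
    (hy : f y = 0) (hy₀ : f y₀ = 0) (h₀ : y₀ ≠ 0) : ∃ a b : ℤ, a ≠ 0 ∧ a • y = b • y₀ := by
  have hexp : ∀ x, f x = x 0 * f (Pi.single 0 1) + x 1 * f (Pi.single 1 1) := by
    intro x
    have h1 : x = x 0 • Pi.single 0 1 + x 1 • Pi.single 1 1 := by
      ext i
      fin_cases i <;> simp
    conv_lhs => rw [h1, map_add, map_zsmul, map_zsmul]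
    rfl
  rw [hexp] at hy hy₀
  have hdet : y₀ 0 * y 1 = y₀ 1 * y 0 := by
    by_contra hne
    have h0 : (y₀ 0 * y 1 - y₀ 1 * y 0) * f (Pi.single 0 1) = 0 := by
      linear_combination y 1 * hy₀ - y₀ 1 * hy
    have h1 : (y₀ 0 * y 1 - y₀ 1 * y 0) * f (Pi.single 1 1) = 0 := by
      linear_combination y₀ 0 * hy - y 0 * hy₀
    rw [mul_eq_zero, or_iff_right (sub_ne_zero.2 hne)] at h0 h1
    exact hf (AddMonoidHom.ext fun x => by rw [hexp, h0, h1]; simp)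
  by_cases h : y₀ 0 = 0
  · refine ⟨y₀ 1, y 1, fun h' => h₀ ?_, ?_⟩
    · ext i
      fin_cases i
      · exact h
      · exact h'
    · ext i
      fin_cases i
      · simp [← hdet, h]
      · exact mul_comm _ _
  · refine ⟨y₀ 0, y 0, h, ?_⟩
    ext i
    fin_cases i
    · exact mul_comm _ _
    · exact hdet.trans (mul_comm _ _)

variable {m m₁ m₂ : ℕ}

theorem exists_maximal_hasHyperbolic_of_ne_zero {β : (Fin m → ℤ) →+ (Fin m → ℤ) →+ (Fin 2 → ℤ)}
    (h : ∃ v w, altForm β v w ≠ 0) :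
    ∃ n, n ≠ 0 ∧ HasHyperbolic (altForm β) n ∧ ¬ HasHyperbolic (altForm β) (n + 1) := by
  obtain ⟨v, w, hvw⟩ := h
  obtain ⟨n, hn, h⟩ := exists_maximal_hasHyperbolic (altForm β) (k := 1)
    ⟨fun _ => v, fun _ => w, _, hvw, fun i j => altForm_self β v, fun i j => altForm_self β w,
      fun i j => by rw [if_pos (Subsingleton.elim i j)]⟩
  exact ⟨n, by omega, h⟩

/-- All commutator values lie in the rank-one group `ker f`. A coordinate that is nonzero on one of
them is injective on `ker f`, so a hyperbolic family for that coordinate is one for the whole form.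
-/
theorem separatedBy_heisenberg_of_functional {β : (Fin m → ℤ) →+ (Fin m → ℤ) →+ (Fin 2 → ℤ)}
    (hβ : FormNondegenerate (altForm β)) (hne : ∃ v w, altForm β v w ≠ 0)
    {f : (Fin 2 → ℤ) →+ ℤ} (hf : f ≠ 0) (hfβ : ∀ v w, f (altForm β v w) = 0) :
    ∃ n, n ≠ 0 ∧ SeparatedBy (TwistedProd β) (HeisenbergGroup n) ∧
      SeparatedBy (HeisenbergGroup n) (TwistedProd β) := by
  obtain ⟨n, hn, hyp, hmax⟩ := exists_maximal_hasHyperbolic_of_ne_zero hne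
  refine ⟨n, hn, separatedBy_heisenbergGroup hβ fun z hz => ?_, separatedBy_of_hasHyperbolic hyp⟩
  obtain ⟨i, hi⟩ := Function.ne_iff.1 hz
  refine ⟨Pi.evalAddMonoidHom _ i, hi, fun h => hmax ?_⟩
  obtain ⟨e, f', d, hd, -, -, hef⟩ := id h
  have hy₀ : altForm β (e 0) (f' 0) i = d := by
    have := hef 0 0
    rwa [if_pos rfl] at this
  refine h.transfer (AddMonoidHom.id _) (AddMonoidHom.id _) (fun _ _ => rfl) _ f.ker hfβ
    fun y hy => ⟨fun hyi => ?_, fun hy0 => by rw [show y = 0 from hy0, map_zero]⟩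
  have hyi' : y i = 0 := hyi
  obtain ⟨a, b, ha, hab⟩ := exists_smul_eq_smul_of_map_eq_zero hf hy (hfβ (e 0) (f' 0))
    fun h0 => hd (by rw [← hy₀, h0]; rfl)
  have hb : b = 0 := by
    have h1 := congrFun hab i
    rw [Pi.smul_apply, Pi.smul_apply, hyi', hy₀, smul_zero] at h1
    exact (smul_eq_zero.1 h1.symm).resolve_right hd
  rw [hb, zero_smul] at hab
  exact (smul_eq_zero.1 hab).resolve_left ha

/-- Each coordinate of the first component is a functional of `z` that kills commutators, since
these map to commutators; `hfull` makes it zero. -/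
theorem fst_map_mk_zero {β₁ : (Fin m₁ → ℤ) →+ (Fin m₁ → ℤ) →+ (Fin 2 → ℤ)}
    {β₂ : (Fin m₂ → ℤ) →+ (Fin m₂ → ℤ) →+ (Fin 2 → ℤ)}
    (hfull : ∀ f : (Fin 2 → ℤ) →+ ℤ, (∀ v w, f (altForm β₁ v w) = 0) → f = 0)
    (φ : TwistedProd β₁ →* TwistedProd β₂) (z : Fin 2 → ℤ) : (φ ⟨0, z⟩).fst = 0 := by
  ext i
  let f : (Fin 2 → ℤ) →+ ℤ := AddMonoidHom.mk' (fun z => (φ ⟨0, z⟩).fst i) fun x y => by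
    have := map_mul (φ.comp (TwistedProd.inr β₁)) (Multiplicative.ofAdd x) (Multiplicative.ofAdd y)
    exact congrFun (congrArg TwistedProd.fst this) i
  have h0 : f = 0 := hfull f fun v w => by
    have h1 := map_commutatorElement φ (⟨v, 0⟩ : TwistedProd β₁) ⟨w, 0⟩
    rw [TwistedProd.commutator_eq, TwistedProd.commutator_eq] at h1
    exact congrFun (congrArg TwistedProd.fst h1) i
  exact DFunLike.congr_fun h0 z

/-- A homomorphism detecting `z` but not injective on the central part induces a rank-one map `h`
there. A coordinate of `h` nonzero at `z` then has the same kernel as `h`, so hyperbolic families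
for this coordinate transfer to the second form, where their size is bounded. -/
theorem separatedBy_heisenberg_of_not_injective
    {β₁ : (Fin m₁ → ℤ) →+ (Fin m₁ → ℤ) →+ (Fin 2 → ℤ)}
    {β₂ : (Fin m₂ → ℤ) →+ (Fin m₂ → ℤ) →+ (Fin 2 → ℤ)}
    (hβ₁ : FormNondegenerate (altForm β₁)) (hne : ∃ v w, altForm β₂ v w ≠ 0)
    (hfull : ∀ f : (Fin 2 → ℤ) →+ ℤ, (∀ v w, f (altForm β₁ v w) = 0) → f = 0)
    (hsep : SeparatedBy (TwistedProd β₁) (TwistedProd β₂))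
    (hninj : ∀ φ : TwistedProd β₁ →* TwistedProd β₂, ∃ z, z ≠ 0 ∧ φ ⟨0, z⟩ = 1) :
    ∃ n, n ≠ 0 ∧ SeparatedBy (TwistedProd β₁) (HeisenbergGroup n) ∧
      SeparatedBy (HeisenbergGroup n) (TwistedProd β₂) := by
  obtain ⟨n, hn, hyp, hmax⟩ := exists_maximal_hasHyperbolic_of_ne_zero hne
  refine ⟨n, hn, separatedBy_heisenbergGroup hβ₁ fun z hz => ?_, separatedBy_of_hasHyperbolic hyp⟩
  obtain ⟨φ, hφz⟩ := hsep ⟨0, z⟩ (mt TwistedProd.mk_zero_eq_one.1 hz)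
  have hφ := fst_map_mk_zero hfull φ
  let h := TwistedProd.inducedSnd φ hφ
  have hmap : ∀ y, φ ⟨0, y⟩ = ⟨0, h y⟩ := TwistedProd.map_mk_zero φ hφ
  obtain ⟨y₀, hy₀, hφy₀⟩ := hninj φ
  rw [hmap, TwistedProd.mk_zero_eq_one] at hφy₀
  have hhz : h z ≠ 0 := by rwa [hmap, Ne, TwistedProd.mk_zero_eq_one] at hφz
  obtain ⟨i, hi⟩ := Function.ne_iff.1 hhz
  let g : (Fin 2 → ℤ) →+ ℤ := (Pi.evalAddMonoidHom _ i).comp h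
  have hg : g ≠ 0 := fun h0 => hi (DFunLike.congr_fun h0 z)
  refine ⟨g, hi, fun hyp' => hmax ?_⟩
  refine hyp'.transfer (TwistedProd.inducedFst φ hφ) h (TwistedProd.altForm_induced φ hφ) g ⊤
    (fun _ _ => AddSubgroup.mem_top _) fun y _ => ⟨fun hy => ?_, fun hy => ?_⟩
  · obtain ⟨a, b, ha, hab⟩ := exists_smul_eq_smul_of_map_eq_zero hg hy
      (show g y₀ = 0 from congrFun hφy₀ i) hy₀
    have h1 := congrArg h hab
    rw [map_zsmul, map_zsmul, hφy₀, smul_zero] at h1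
    exact (smul_eq_zero.1 h1).resolve_left ha
  · exact congrFun hy i

/-! ### Mutual embeddings -/

theorem exists_smul_mem_range {k : ℕ} (u : (Fin k → ℤ) →+ (Fin k → ℤ)) (hu : Function.Injective u)
    (v : Fin k → ℤ) : ∃ n : ℕ, 0 < n ∧ ∃ w, u w = n • v := by
  let A := LinearMap.toMatrix' u.toIntLinearMap
  have hA : ∀ w, A.mulVec w = u w := fun w => LinearMap.toMatrix'_mulVec u.toIntLinearMap w
  have hdet : A.det ≠ 0 := fun h0 => by
    obtain ⟨w, hw, hw0⟩ := Matrix.exists_mulVec_eq_zero_iff.2 h0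
    rw [hA] at hw0
    exact hw (hu (hw0.trans (map_zero u).symm))
  -- From `A * adjugate A = det A`; the sign turns the determinant into a positive multiplier.
  refine ⟨A.det.natAbs, Int.natAbs_pos.2 hdet, A.det.sign • A.adjugate.mulVec v, ?_⟩
  rw [map_zsmul, ← hA, Matrix.mulVec_mulVec, Matrix.mul_adjugate, Matrix.smul_mulVec,
    Matrix.one_mulVec, smul_smul, Int.sign_mul_self_eq_natAbs]
  simp

theorem isoMalcevCompletions_of_injective {G₁ G₂ : Type*} [Group G₁] [Group G₂]
    {β₁ : (Fin m₁ → ℤ) →+ (Fin m₁ → ℤ) →+ (Fin 2 → ℤ)}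
    {β₂ : (Fin m₂ → ℤ) →+ (Fin m₂ → ℤ) →+ (Fin 2 → ℤ)}
    (e₁ : TwistedProd β₁ ≃* G₁) (e₂ : TwistedProd β₂ ≃* G₂)
    (hβ₁ : FormNondegenerate (altForm β₁)) (hβ₂ : FormNondegenerate (altForm β₂))
    (φ : TwistedProd β₁ →* TwistedProd β₂) (hφ : ∀ z, (φ ⟨0, z⟩).fst = 0)
    (hφinj : ∀ z, φ ⟨0, z⟩ = 1 → z = 0)
    (ψ : TwistedProd β₂ →* TwistedProd β₁) (hψ : ∀ z, (ψ ⟨0, z⟩).fst = 0)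
    (hψinj : ∀ z, ψ ⟨0, z⟩ = 1 → z = 0) : IsoMalcevCompletions G₁ G₂ := by
  have hinj : ∀ {m₁ m₂ : ℕ} {β₁ : (Fin m₁ → ℤ) →+ (Fin m₁ → ℤ) →+ (Fin 2 → ℤ)}
      {β₂ : (Fin m₂ → ℤ) →+ (Fin m₂ → ℤ) →+ (Fin 2 → ℤ)} (_ : FormNondegenerate (altForm β₁))
      (φ : TwistedProd β₁ →* TwistedProd β₂) (hφ : ∀ z, (φ ⟨0, z⟩).fst = 0)
      (_ : ∀ z, φ ⟨0, z⟩ = 1 → z = 0), Function.Injective (TwistedProd.inducedFst φ hφ) := by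
    intro m₁ m₂ β₁ β₂ hβ₁ φ hφ hφinj
    refine (injective_iff_map_eq_zero _).2 fun v hv => hβ₁ v fun w => hφinj _ ?_
    rw [TwistedProd.map_mk_zero φ hφ, ← TwistedProd.altForm_induced, hv, map_zero]
    rfl
  have hu := hinj hβ₁ φ hφ hφinj
  have hle : ∀ {m₁ m₂ : ℕ} (u : (Fin m₁ → ℤ) →+ (Fin m₂ → ℤ)), Function.Injective u → m₁ ≤ m₂ :=
    fun u hu => by
      simpa using LinearMap.finrank_le_finrank_of_injective (f := u.toIntLinearMap) hu
  obtain rfl : m₁ = m₂ := le_antisymm (hle _ hu) (hle _ (hinj hβ₂ ψ hψ hψinj))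
  have hh : Function.Injective (TwistedProd.inducedSnd φ hφ) :=
    (injective_iff_map_eq_zero _).2 fun z hz => hφinj z (by
      rw [TwistedProd.map_mk_zero φ hφ, hz]
      rfl)
  have hφ' : Function.Injective φ := (injective_iff_map_eq_one φ).2 fun x hx => by
    have h1 : x.fst = 0 := hu (by rw [← TwistedProd.fst_map, hx, map_zero]; rfl)
    have h2 : x = ⟨0, x.snd⟩ := TwistedProd.ext h1 rfl
    rw [h2] at hx
    rw [h2, hφinj _ hx]
    rfl
  -- First a power of `x` is matched in the first component; the remaining discrepancy is central,
  -- and a further power of it comes from the central part of the source.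
  have hpow : ∀ x, ∃ n : ℕ, 0 < n ∧ x ^ n ∈ φ.range := by
    intro x
    obtain ⟨n, hn, w, hw⟩ := exists_smul_mem_range _ hu x.fst
    have h1 : (φ ⟨w, 0⟩).fst = (x ^ n).fst := by
      rw [TwistedProd.fst_map φ hφ, hw, TwistedProd.fst_pow]
    obtain ⟨k, hk, z, hz⟩ := exists_smul_mem_range _ hh ((φ ⟨w, 0⟩)⁻¹ * x ^ n).snd
    have h2 : x ^ n = φ ⟨w, 0⟩ * ⟨0, ((φ ⟨w, 0⟩)⁻¹ * x ^ n).snd⟩ := by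
      rw [← inv_mul_eq_iff_eq_mul]
      exact TwistedProd.ext
        (by rw [TwistedProd.fst_mul, TwistedProd.fst_inv, h1, neg_add_cancel]) rfl
    refine ⟨n * k, Nat.mul_pos hn hk, ⟨w, 0⟩ ^ k * ⟨0, z⟩, ?_⟩
    have h3 : Commute (φ ⟨w, 0⟩) ⟨0, ((φ ⟨w, 0⟩)⁻¹ * x ^ n).snd⟩ :=
      Subgroup.mem_center_iff.1 (TwistedProd.mk_zero_mem_center _) _
    rw [pow_mul, h2, h3.mul_pow, map_mul, map_pow, TwistedProd.map_mk_zero φ hφ, hz,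
      TwistedProd.mk_zero_nsmul]
  obtain ⟨D, _, ι, hι⟩ := exists_isMalcevCompletion β₂
  -- A single `D` completes both groups; lifting only places it in their respective universes.
  refine ⟨ULift D, inferInstance, _, ULift D, inferInstance, _,
    ((hι φ hφ' hpow).comp_mulEquiv e₁.symm).trans_mulEquiv MulEquiv.ulift.symm,
    ((hι (MonoidHom.id _) Function.injective_id fun x => ⟨1, one_pos, x ^ 1, rfl⟩).comp_mulEquiv
      e₂.symm).trans_mulEquiv MulEquiv.ulift.symm,
    ⟨MulEquiv.ulift.trans MulEquiv.ulift.symm⟩⟩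

/-! ### Classification -/

theorem exists_heisenberg_or_isoMalcevCompletions {G₁ G₂ : Type*} [Group G₁] [Group G₂]
    {β₁ : (Fin m₁ → ℤ) →+ (Fin m₁ → ℤ) →+ (Fin 2 → ℤ)}
    {β₂ : (Fin m₂ → ℤ) →+ (Fin m₂ → ℤ) →+ (Fin 2 → ℤ)}
    (e₁ : TwistedProd β₁ ≃* G₁) (e₂ : TwistedProd β₂ ≃* G₂)
    (hβ₁ : FormNondegenerate (altForm β₁)) (hβ₂ : FormNondegenerate (altForm β₂))
    (hne₁ : ∃ v w, altForm β₁ v w ≠ 0) (hne₂ : ∃ v w, altForm β₂ v w ≠ 0)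
    (h₁₂ : SeparatedBy (TwistedProd β₁) (TwistedProd β₂))
    (h₂₁ : SeparatedBy (TwistedProd β₂) (TwistedProd β₁)) :
    (∃ n, n ≠ 0 ∧ SeparatedBy (TwistedProd β₁) (HeisenbergGroup n) ∧
      SeparatedBy (HeisenbergGroup n) (TwistedProd β₁)) ∨ IsoMalcevCompletions G₁ G₂ := by
  by_cases hfull₁ : ∀ f : (Fin 2 → ℤ) →+ ℤ, (∀ v w, f (altForm β₁ v w) = 0) → f = 0
  swap
  · push Not at hfull₁
    obtain ⟨f, hfβ, hf⟩ := hfull₁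
    exact Or.inl (separatedBy_heisenberg_of_functional hβ₁ hne₁ hf hfβ)
  by_cases hfull₂ : ∀ f : (Fin 2 → ℤ) →+ ℤ, (∀ v w, f (altForm β₂ v w) = 0) → f = 0
  swap
  · push Not at hfull₂
    obtain ⟨f, hfβ, hf⟩ := hfull₂
    obtain ⟨n, hn, h, h'⟩ := separatedBy_heisenberg_of_functional hβ₂ hne₂ hf hfβ
    exact Or.inl ⟨n, hn, h₁₂.trans h, h'.trans h₂₁⟩
  by_cases hφ : ∃ φ : TwistedProd β₁ →* TwistedProd β₂, ∀ z, φ ⟨0, z⟩ = 1 → z = 0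
  swap
  · push Not at hφ
    obtain ⟨n, hn, h, h'⟩ := separatedBy_heisenberg_of_not_injective hβ₁ hne₂ hfull₁ h₁₂
      fun φ => (hφ φ).imp fun z hz => hz.symm
    exact Or.inl ⟨n, hn, h, h'.trans h₂₁⟩
  by_cases hψ : ∃ ψ : TwistedProd β₂ →* TwistedProd β₁, ∀ z, ψ ⟨0, z⟩ = 1 → z = 0
  swap
  · push Not at hψ
    obtain ⟨n, hn, h, h'⟩ := separatedBy_heisenberg_of_not_injective hβ₂ hne₁ hfull₂ h₂₁
      fun φ => (hψ φ).imp fun z hz => hz.symm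
    exact Or.inl ⟨n, hn, h₁₂.trans h, h'⟩
  obtain ⟨φ, hφ⟩ := hφ
  obtain ⟨ψ, hψ⟩ := hψ
  exact Or.inr (isoMalcevCompletions_of_injective e₁ e₂ hβ₁ hβ₂ φ (fst_map_mk_zero hfull₁ φ) hφ ψ
    (fst_map_mk_zero hfull₂ ψ) hψ)

end GeomEquivalence

open GeomEquivalence in
theorem theorem4 (Θ : Set (FreeGroup ℕ))
    (G₁ G₂ : Type*) [Group G₁] [Group G₂]
    (hΘ₁ : GeomEquivalence.InVariety Θ G₁) (hΘ₂ : GeomEquivalence.InVariety Θ G₂)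
    (h₁ : GeomEquivalence.IsFGTorsionFreeClassTwo G₁)
    (h₂ : GeomEquivalence.IsFGTorsionFreeClassTwo G₂)
    (hr₁ : GeomEquivalence.centerRank G₁ = 2)
    (hr₂ : GeomEquivalence.centerRank G₂ = 2) :
    GeomEquivalence.GeomEquiv Θ G₁ G₂ ↔
      (∃ (N : Type) (_ : Group N),
        GeomEquivalence.IsFGTorsionFreeClassTwo N ∧ IsCyclic (Subgroup.center N) ∧
          GeomEquivalence.GeomEquiv Θ G₁ N ∧ GeomEquivalence.GeomEquiv Θ N G₂) ∨
      GeomEquivalence.IsoMalcevCompletions G₁ G₂ := by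
  have := h₁.fg
  have := h₂.fg
  obtain ⟨m₁, β₁, hβ₁, hne₁, ⟨e₁⟩⟩ := h₁.exists_mulEquiv hr₁
  obtain ⟨m₂, β₂, hβ₂, hne₂, ⟨e₂⟩⟩ := h₂.exists_mulEquiv hr₂
  have hE₁ : SeparatedBy (TwistedProd β₁) G₁ := .of_injective e₁.toMonoidHom e₁.injective
  have hE₂ : SeparatedBy (TwistedProd β₂) G₂ := .of_injective e₂.toMonoidHom e₂.injective
  have hG₁ : SeparatedBy G₁ (TwistedProd β₁) := .of_injective e₁.symm.toMonoidHom e₁.symm.injective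
  have hG₂ : SeparatedBy G₂ (TwistedProd β₂) := .of_injective e₂.symm.toMonoidHom e₂.symm.injective
  constructor
  · intro h
    obtain ⟨-, -, h₁₂, h₂₁⟩ := geomEquiv_iff.1 h
    refine (exists_heisenberg_or_isoMalcevCompletions e₁ e₂ hβ₁ hβ₂ hne₁ hne₂
      ((hE₁.trans h₁₂).trans hG₂) ((hE₂.trans h₂₁).trans hG₁)).imp_left ?_
    rintro ⟨n, hn, hN, hN'⟩
    have hNclass := isFGTorsionFreeClassTwo_heisenbergGroup hn
    have := hNclass.fg
    have h₁N := hG₁.trans hN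
    have hN₁ := hN'.trans hE₁
    -- The Heisenberg group inherits the laws from `G₁`, because its points are separated by
    -- homomorphisms into `G₁`.
    have hΘN := hΘ₁.of_separatedBy hN₁
    exact ⟨HeisenbergGroup n, inferInstance, hNclass, isCyclic_center_heisenbergGroup n,
      geomEquiv_iff.2 ⟨hΘ₁, hΘN, h₁N, hN₁⟩,
      geomEquiv_iff.2 ⟨hΘN, hΘ₂, hN₁.trans h₁₂, h₂₁.trans h₁N⟩⟩
  · rintro (⟨N, _, -, -, ⟨-, -, hN₁⟩, ⟨-, -, hN₂⟩⟩ | ⟨D, _, ι, E, _, κ, hι, hκ, ⟨e⟩⟩)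
    · exact ⟨hΘ₁, hΘ₂, fun X _ T => (hN₁ X T).trans (hN₂ X T)⟩
    · have hι' := (hι.trans_mulEquiv e).comp_mulEquiv e₁
      have hκ' := hκ.comp_mulEquiv e₂
      exact geomEquiv_iff.2 ⟨hΘ₁, hΘ₂, (hG₁.trans (hι'.separatedBy hβ₁ hβ₂ hκ')).trans hE₂,
        (hG₂.trans (hκ'.separatedBy hβ₂ hβ₁ hι')).trans hE₁⟩
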